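/- Let $d\ge 1$, let $\lambda_1,\dots,\lambda_d\in\mathbb C$ be arbitrary, let $\tilde P_1,\dots,\tilde P_d\in\mathbb C[z]$ be nonzero polynomials in one variable (multiple roots are allowed), and put $P_i(z)=(z-\lambda_i)\tilde P_i(z)$. Let $S\subset\mathbb C^{d+2}$ be the (possibly singular) affine algebraic variety, with its reduced structure, of all points $(z_0,\dots,z_{d+1})$ satisfying \[ z_0 z_{i+1}=\Big(\prod_{k=1}^{i-1}\tilde P_k(z_k)\Big)P_i(z_i)\qquad(1\le i\le d), \] \[ (z_{j-1}-\lambda_{j-1})\,z_{i+1}=z_j\Big(\prod_{k=j}^{i-1}\tilde P_k(z_k)\Big)P_i(z_i)\qquad(2\le j\le i\le d), \] where empty products equal $1$. An algebraic vector field on $S$ is a $\mathbb C$-derivation of the ring $\mathbb C[S]$ of regular functions; it is complete if through every point of $S$ it has an integral curve $\mathbb C\to S$ defined for all complex times; it vanishes on $A\subset S$ if its value at each point of $A$ is the zero tangent vector. Then there exists a finite set $A\subset S$ such that $S$ has the algebraic density property relative to $A$, i.e. there is an integer $\ell\ge 0$ with \[ \mathcal I_A^{\ell}\cdot \mathrm{VF}_{\mathrm{alg}}(S,A)\subseteq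 \mathrm{Lie}_{\mathrm{alg}}(S,A), \] where $\mathcal I_A\subset\mathbb C[S]$ is the ideal of functions vanishing on $A$, $\mathrm{VF}_{\mathrm{alg}}(S,A)$ is the $\mathbb C[S]$-module of all algebraic vector fields on $S$ vanishing on $A$, and $\mathrm{Lie}_{\mathrm{alg}}(S,A)$ is the Lie algebra over $\mathbb C$ generated by the complete algebraic vector fields on $S$ vanishing on $A$. In particular this holds for every Gizatullin surface given by these equations. -/

import Mathlib

open MvPolynomial

namespace AffVar

noncomputable section

/-- The algebra `ℂ[X]` of regular functions on a Zariski-closed set `X ⊆ ℂ^σ`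
(with its reduced structure): polynomials modulo those vanishing at every point of `X`. -/
abbrev CoordRing {σ : Type} (X : Set (σ → ℂ)) : Type :=
  MvPolynomial σ ℂ ⧸ vanishingIdeal ℂ X

/-- The value of regular functions at a point `p` of `X`. -/
def evalAt {σ : Type} {X : Set (σ → ℂ)} (p : X) : CoordRing X →ₐ[ℂ] ℂ :=
  Ideal.Quotient.liftₐ (vanishingIdeal ℂ X) (aeval (p : σ → ℂ)) (fun _ hf => hf p.1 p.2)

/-- Algebraic vector fields on `X`: the `ℂ`-derivations of `ℂ[X]`. They form a `ℂ[X]`-module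
and a Lie algebra over `ℂ` under the commutator bracket. -/
abbrev VF {σ : Type} (X : Set (σ → ℂ)) : Type :=
  Derivation ℂ (CoordRing X) (CoordRing X)

/-- A vector field is (`ℂ`-)complete if through every point of `X` there is an integral curve
in `X` that is defined for all complex times. -/
def IsComplete {σ : Type} {X : Set (σ → ℂ)} (θ : VF X) : Prop :=
  ∀ p : X, ∃ γ : ℂ → X, γ 0 = p ∧
    ∀ (t : ℂ) (f : CoordRing X), HasDerivAt (fun s => evalAt (γ s) f) (evalAt (γ t) (θ f)) t

/-- The ideal `I_A` of regular functions on `X` that vanish on `A`. -/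
def idealOf {σ : Type} {X : Set (σ → ℂ)} (A : Set X) : Ideal (CoordRing X) :=
  ⨅ p ∈ A, RingHom.ker (evalAt p)

/-- `VF_alg(X, A)`: the algebraic vector fields that vanish (as tangent vectors) at every point
of `A`. -/
def VFVanishing {σ : Type} {X : Set (σ → ℂ)} (A : Set X) : Submodule (CoordRing X) (VF X) where
  carrier := {θ | ∀ p ∈ A, ∀ f, evalAt p (θ f) = 0}
  zero_mem' := fun p _ f => by simp
  add_mem' := fun {θ η} hθ hη p hp f => by simp [hθ p hp f, hη p hp f]
  smul_mem' := fun g θ hθ p hp f => by simp [hθ p hp f]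

/-- `Lie_alg(X, A)`: the Lie algebra generated by the complete algebraic vector fields on `X`
that vanish on `A`. -/
def LieComplete {σ : Type} {X : Set (σ → ℂ)} (A : Set X) : LieSubalgebra ℂ (VF X) :=
  LieSubalgebra.lieSpan ℂ (VF X) {θ | IsComplete θ ∧ θ ∈ VFVanishing A}

/-- The algebraic density property of `X` relative to `A`:
`I_A ^ ℓ · VF_alg(X, A) ⊆ Lie_alg(X, A)` for some `ℓ ≥ 0`. -/
def HasRelativeADP {σ : Type} (X : Set (σ → ℂ)) (A : Set X) : Prop :=
  ∃ ℓ : ℕ, ((idealOf A ^ ℓ • VFVanishing A : Submodule (CoordRing X) (VF X)) : Set (VF X)) ⊆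
    (LieComplete A : Set (VF X))

/-- The coordinate `z_k` of `z = (z_0, …, z_{d+1})`. It is only used for `k ≤ d + 1`, where
`Fin.ofNat (d + 2) k` is the index `k`. -/
def coord {d : ℕ} (z : Fin (d + 2) → ℂ) (k : ℕ) : ℂ := z (Fin.ofNat (d + 2) k)

/-- `P_i = (z - λ_i) · P̃_i`. -/
def fullPoly (lam : ℕ → ℂ) (Pt : ℕ → Polynomial ℂ) (i : ℕ) : Polynomial ℂ :=
  (Polynomial.X - Polynomial.C (lam i)) * Pt i

/-- The surface in `ℂ^{d+2}` with parameters `λ_1, …, λ_d` and `P̃_1, …, P̃_d` (the values of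
`lam` and `Pt` outside `1, …, d` play no role). -/
def surface (d : ℕ) (lam : ℕ → ℂ) (Pt : ℕ → Polynomial ℂ) : Set (Fin (d + 2) → ℂ) :=
  {z | (∀ i, 1 ≤ i → i ≤ d →
          coord z 0 * coord z (i + 1) =
            (∏ k ∈ Finset.Ico 1 i, (Pt k).eval (coord z k)) *
              (fullPoly lam Pt i).eval (coord z i)) ∧
       (∀ j i, 2 ≤ j → j ≤ i → i ≤ d →
          (coord z (j - 1) - lam (j - 1)) * coord z (i + 1) =
            coord z j * (∏ k ∈ Finset.Ico j i, (Pt k).eval (coord z k)) *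
              (fullPoly lam Pt i).eval (coord z i))}

end

end AffVar

namespace AffVar

/-! ### The equations over an arbitrary `ℂ`-algebra and their charts -/

section Relations

variable {Q Q' : Type*} [CommRing Q] [Algebra ℂ Q] [CommRing Q'] [Algebra ℂ Q']
variable {d : ℕ} {lam : ℕ → ℂ} {Pt : ℕ → Polynomial ℂ}

/-- The shifted coordinate `z_i - λ_i`. -/
def shift (lam : ℕ → ℂ) (z : ℕ → Q) (i : ℕ) : Q := z i - algebraMap ℂ Q (lam i)

/-- The coordinate `z_{j+1}`, replaced by `1` when `j = 0`. -/
def next (z : ℕ → Q) (j : ℕ) : Q := if j = 0 then 1 else z (j + 1)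

/-- The equations of the surface for a sequence of elements of a `ℂ`-algebra
(in the normalization `λ_0 = 0`). -/
def Rel (d : ℕ) (lam : ℕ → ℂ) (Pt : ℕ → Polynomial ℂ) (z : ℕ → Q) : Prop :=
  ∀ j i, j < i → i ≤ d →
    shift lam z j * z (i + 1) =
      next z j * shift lam z i * ∏ l ∈ Finset.Ioc j i, Polynomial.aeval (z l) (Pt l)

omit [Algebra ℂ Q] in
theorem next_zero (z : ℕ → Q) : next z 0 = 1 := rfl

omit [Algebra ℂ Q] in
theorem next_of_pos (z : ℕ → Q) {j : ℕ} (hj : 0 < j) : next z j = z (j + 1) := by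
  simp [next, hj.ne']

theorem next_mem (S : Subalgebra ℂ Q) {z : ℕ → Q} {j : ℕ} (h : z (j + 1) ∈ S) :
    next z j ∈ S := by
  unfold next; split_ifs
  exacts [S.one_mem, h]

theorem shift_mem (S : Subalgebra ℂ Q) {z : ℕ → Q} {j : ℕ} (h : z j ∈ S) :
    shift lam z j ∈ S := S.sub_mem h (S.algebraMap_mem _)

theorem mem_of_shift_mem (S : Subalgebra ℂ Q) {z : ℕ → Q} {j : ℕ} (h : shift lam z j ∈ S) :
    z j ∈ S := by
  simpa [shift] using S.add_mem h (S.algebraMap_mem (lam j))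

theorem aeval_mem (S : Subalgebra ℂ Q) {q : Q} (h : q ∈ S) (p : Polynomial ℂ) :
    Polynomial.aeval q p ∈ S :=
  Algebra.adjoin_le (Set.singleton_subset_iff.2 h) (Polynomial.aeval_mem_adjoin_singleton ℂ q)

theorem Rel.mono {d' : ℕ} {z : ℕ → Q} (h : Rel d lam Pt z) (hd : d' ≤ d) : Rel d' lam Pt z :=
  fun j i hj hi => h j i hj (hi.trans hd)

theorem Rel.congr {z z' : ℕ → Q} (h : Rel d lam Pt z) (hz : ∀ i ≤ d + 1, z' i = z i) :
    Rel d lam Pt z' := by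
  intro j i hj hi
  have e1 : shift lam z' j = shift lam z j := by simp [shift, hz j (by omega)]
  have e2 : shift lam z' i = shift lam z i := by simp [shift, hz i (by omega)]
  have e3 : next z' j = next z j := by simp [next, hz (j + 1) (by omega)]
  rw [e1, e2, e3, hz (i + 1) (by omega), h j i hj hi]
  congr 1
  refine Finset.prod_congr rfl fun l hl => ?_
  rw [hz l (by have := (Finset.mem_Ioc.1 hl).2; omega)]

theorem shift_map (f : Q →ₐ[ℂ] Q') (z : ℕ → Q) (i : ℕ) :
    shift lam (fun k => f (z k)) i = f (shift lam z i) := by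
  simp [shift]

theorem next_map (f : Q →ₐ[ℂ] Q') (z : ℕ → Q) (i : ℕ) :
    next (fun k => f (z k)) i = f (next z i) := by
  unfold next; split_ifs <;> simp

theorem Rel.map {z : ℕ → Q} (h : Rel d lam Pt z) (f : Q →ₐ[ℂ] Q') :
    Rel d lam Pt (fun k => f (z k)) := by
  intro j i hj hi
  have := congrArg f (h j i hj hi)
  simp only [map_mul, map_prod, ← Polynomial.aeval_algHom_apply] at this
  rw [shift_map, shift_map, next_map, this]

/-- Two solutions form a single solution over a product ring, so a comparison of them becomes
membership in an equalizer subalgebra. -/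
theorem Rel.prod {z : ℕ → Q} {z' : ℕ → Q'} (h : Rel d lam Pt z) (h' : Rel d lam Pt z') :
    Rel d lam Pt (fun k => (z k, z' k)) := by
  intro j i hj hi
  have key : ∀ (f : Q × Q' →ₐ[ℂ] Q), (∀ k, f (z k, z' k) = z k) →
      f (shift lam (fun k => (z k, z' k)) j * (z (i + 1), z' (i + 1))) =
      f (next (fun k => (z k, z' k)) j * shift lam (fun k => (z k, z' k)) i *
        ∏ l ∈ Finset.Ioc j i, Polynomial.aeval (z l, z' l) (Pt l)) := by
    intro f hf
    simp only [map_mul, map_prod, ← Polynomial.aeval_algHom_apply, ← shift_map, ← next_map, hf]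
    exact h j i hj hi
  have key' : ∀ (f : Q × Q' →ₐ[ℂ] Q'), (∀ k, f (z k, z' k) = z' k) →
      f (shift lam (fun k => (z k, z' k)) j * (z (i + 1), z' (i + 1))) =
      f (next (fun k => (z k, z' k)) j * shift lam (fun k => (z k, z' k)) i *
        ∏ l ∈ Finset.Ioc j i, Polynomial.aeval (z l, z' l) (Pt l)) := by
    intro f hf
    simp only [map_mul, map_prod, ← Polynomial.aeval_algHom_apply, ← shift_map, ← next_map, hf]
    exact h' j i hj hi
  exact Prod.ext (key (AlgHom.fst ℂ Q Q') fun _ => rfl) (key' (AlgHom.snd ℂ Q Q') fun _ => rfl)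

theorem Rel.pi {I : Type*} {z : ℕ → I → ℂ} (h : ∀ s, Rel d lam Pt (fun k => z k s)) :
    Rel d lam Pt z := by
  intro j i hj hi
  funext s
  have key : ∀ (f : (I → ℂ) →ₐ[ℂ] ℂ), (∀ k, f (z k) = z k s) →
      f (shift lam z j * z (i + 1)) =
      f (next z j * shift lam z i * ∏ l ∈ Finset.Ioc j i, Polynomial.aeval (z l) (Pt l)) := by
    intro f hf
    simp only [map_mul, map_prod, ← Polynomial.aeval_algHom_apply, ← shift_map, ← next_map, hf]
    exact h s j i hj hi
  exact key (Pi.evalAlgHom ℂ (fun _ : I => ℂ) s) fun _ => rfl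

/-- Coordinates below `i` are determined by `z_i` and `z_{i+1}` up to division by `z_{i+1}`. -/
theorem Rel.mem_of_le {z : ℕ → Q} (h : Rel d lam Pt z) (S : Subalgebra ℂ Q) {i : ℕ} (hi : i ≤ d)
    (h1 : z i ∈ S) (h2 : z (i + 1) ∈ S) (hdiv : ∀ q, z (i + 1) * q ∈ S → q ∈ S) :
    ∀ l ≤ i + 1, z l ∈ S := by
  have key : ∀ n ≤ i, ∀ l, i - n ≤ l → l ≤ i + 1 → z l ∈ S := by
    intro n
    induction n with
    | zero =>
      intro _ l hl hl'
      obtain rfl | rfl : l = i ∨ l = i + 1 := by omega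
      exacts [h1, h2]
    | succ n ih =>
      intro hn l hl hl'
      have ih := ih (by omega)
      by_cases hln : i - n ≤ l
      · exact ih l hln hl'
      · refine mem_of_shift_mem (lam := lam) S (hdiv _ ?_)
        rw [mul_comm, h l i (by omega) hi]
        refine S.mul_mem (S.mul_mem (next_mem S (ih _ (by omega) (by omega))) (shift_mem S h1)) ?_
        refine S.prod_mem fun k hk => aeval_mem S (ih k ?_ ?_) _ <;>
          (have := Finset.mem_Ioc.1 hk; omega)
  exact fun l hl => key i le_rfl l (by omega) hl

/-- Coordinates above `k` are determined by `z_k` and `z_{k+1}` up to division by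
`z_k - λ_k`. -/
theorem Rel.mem_of_ge {z : ℕ → Q} (h : Rel d lam Pt z) (S : Subalgebra ℂ Q) {k : ℕ}
    (h1 : z k ∈ S) (h2 : z (k + 1) ∈ S) (hdiv : ∀ q, shift lam z k * q ∈ S → q ∈ S) :
    ∀ l, k ≤ l → l ≤ d + 1 → z l ∈ S := by
  intro l
  induction l using Nat.strong_induction_on with
  | _ l ih =>
    intro hl hl'
    rcases lt_or_ge (k + 1) l with h3 | h3
    · obtain ⟨i, rfl⟩ : ∃ i, l = i + 1 := ⟨l - 1, by omega⟩
      refine hdiv _ ?_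
      rw [h k i (by omega) (by omega)]
      refine S.mul_mem (S.mul_mem (next_mem S h2) (shift_mem S (ih i ?_ ?_ ?_))) ?_
      · omega
      · omega
      · omega
      refine S.prod_mem fun m hm => aeval_mem S (ih m ?_ ?_ ?_) _ <;>
        (have := Finset.mem_Ioc.1 hm; omega)
    · obtain rfl | rfl : l = k ∨ l = k + 1 := by omega
      exacts [h1, h2]

/-- Downward recursion with `T j` in the role of `(z_j - λ_j) / next_j`, but free of denominators.
-/
theorem exists_lower_chart (lam : ℕ → ℂ) (Pt : ℕ → Polynomial ℂ) (n : ℕ) (zk τ : Q) :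
    ∃ Z T : ℕ → Q, Z (n + 1) = zk ∧ T n = τ ∧ (∀ j ≤ n, shift lam Z j = next Z j * T j) ∧
      ∀ j < n, T j = T (j + 1) * Polynomial.aeval (Z (j + 1)) (Pt (j + 1)) := by
  induction n generalizing zk τ with
  | zero =>
    refine ⟨fun i => if i = 0 then algebraMap ℂ Q (lam 0) + τ else zk, fun _ => τ, ?_, rfl, ?_, ?_⟩
    · simp
    · intro j hj
      obtain rfl : j = 0 := by omega
      simp [shift, next]
    · intro j hj; omega
  | succ n ih =>
    obtain ⟨Z, T, h1, h2, h3, h4⟩ := ih (algebraMap ℂ Q (lam (n + 1)) + zk * τ)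
      (τ * Polynomial.aeval (algebraMap ℂ Q (lam (n + 1)) + zk * τ) (Pt (n + 1)))
    refine ⟨fun i => if i ≤ n + 1 then Z i else zk, fun i => if i ≤ n then T i else τ, ?_, ?_, ?_,
      ?_⟩
    · simp
    · simp
    · intro j hj
      rcases Nat.lt_or_ge n j with h | h
      · obtain rfl : j = n + 1 := by omega
        simp [shift, next, h1]
      · have := h3 j h
        simp only [shift, next] at this ⊢
        simp [h, show j ≤ n + 1 by omega, this]
    · intro j hj
      rcases Nat.lt_or_ge j n with h | h
      · simp [h.le, show j + 1 ≤ n by omega, h4 j h]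
      · obtain rfl : j = n := by omega
        simp [h1, h2]

/-- Upward recursion with `T i` in the role of `z_{i+1} / (z_i - λ_i)`, again without denominators.
-/
theorem exists_upper_chart (lam : ℕ → ℂ) (Pt : ℕ → Polynomial ℂ) (k : ℕ) (zk t : Q) :
    ∃ Z T : ℕ → Q, Z k = zk ∧ T k = t ∧ ∀ i ≥ k, Z (i + 1) = shift lam Z i * T i ∧
      T (i + 1) = T i * Polynomial.aeval (Z (i + 1)) (Pt (i + 1)) := by
  let step : ℕ → Q × Q → Q × Q := fun i s =>
    ((s.1 - algebraMap ℂ Q (lam i)) * s.2,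
      s.2 * Polynomial.aeval ((s.1 - algebraMap ℂ Q (lam i)) * s.2) (Pt (i + 1)))
  let F : ℕ → Q × Q := Nat.rec (zk, t) fun i s => step (k + i) s
  refine ⟨fun i => (F (i - k)).1, fun i => (F (i - k)).2, by simp [F], by simp [F], ?_⟩
  intro i hi
  obtain ⟨n, rfl⟩ := Nat.exists_eq_add_of_le hi
  have e : k + n + 1 - k = n + 1 := by omega
  simp only [shift, e, Nat.add_sub_cancel_left]
  exact ⟨rfl, rfl⟩

omit [Algebra ℂ Q] in
theorem eq_mul_prod_Ioc {T u : ℕ → Q} {i j : ℕ} (hji : j ≤ i)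
    (h : ∀ l, j ≤ l → l < i → T l = T (l + 1) * u (l + 1)) :
    T j = T i * ∏ l ∈ Finset.Ioc j i, u l := by
  induction i, hji using Nat.le_induction with
  | base => simp
  | succ n hn ih =>
    rw [ih fun l h1 h2 => h l h1 (by omega), h n hn (by omega), Finset.prod_Ioc_succ_top hn]
    ring

omit [Algebra ℂ Q] in
theorem eq_mul_prod_Ioc' {T u : ℕ → Q} {i j : ℕ} (hji : j ≤ i)
    (h : ∀ l, j ≤ l → l < i → T (l + 1) = T l * u (l + 1)) :
    T i = T j * ∏ l ∈ Finset.Ioc j i, u l := by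
  induction i, hji using Nat.le_induction with
  | base => simp
  | succ n hn ih =>
    rw [h n hn (by omega), ih fun l h1 h2 => h l h1 (by omega), Finset.prod_Ioc_succ_top hn]
    ring

/-- The charts `{τ t = P̃_{n+1}(z_{n+1})}` of the surface. -/
theorem exists_chart (lam : ℕ → ℂ) (Pt : ℕ → Polynomial ℂ) (n : ℕ) (zk τ t : Q)
    (ht : n + 1 ≤ d → τ * t = Polynomial.aeval zk (Pt (n + 1))) :
    ∃ Z : ℕ → Q, Rel d lam Pt Z ∧ Z (n + 1) = zk ∧ shift lam Z n = next Z n * τ ∧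
      Z (n + 2) = shift lam Z (n + 1) * t := by
  obtain ⟨Z, T, hZ, hT, h3, h4⟩ := exists_lower_chart lam Pt n zk τ
  obtain ⟨Y, T', hY, hT', h5⟩ := exists_upper_chart lam Pt (n + 1) zk t
  set V : ℕ → Q := fun i => if i ≤ n then Z i else Y i with hV
  have Vle : ∀ i ≤ n + 1, V i = Z i := by
    intro i hi
    rcases Nat.lt_or_ge n i with h | h
    · obtain rfl : i = n + 1 := by omega
      simp [hV, hZ, hY]
    · simp [hV, h]
  have Vge : ∀ i ≥ n + 1, V i = Y i := fun i hi => by simp [hV, show ¬ i ≤ n by omega]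
  have lowS : ∀ j ≤ n, shift lam V j = next V j * T j := by
    intro j hj
    have := h3 j hj
    simp only [shift, next] at this ⊢
    rw [Vle j (by omega), Vle (j + 1) (by omega), this]
  have lowT : ∀ j i, j ≤ i → i ≤ n →
      T j = T i * ∏ l ∈ Finset.Ioc j i, Polynomial.aeval (V l) (Pt l) := fun j i hj hi =>
    eq_mul_prod_Ioc (u := fun l => Polynomial.aeval (V l) (Pt l)) hj fun l _ h2 => by
      simp only [Vle (l + 1) (by omega)]
      exact h4 l (by omega)
  have upS : ∀ i ≥ n + 1, V (i + 1) = shift lam V i * T' i := by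
    intro i hi
    have := (h5 i hi).1
    simp only [shift] at this ⊢
    rw [Vge i hi, Vge (i + 1) (by omega), this]
  have upT : ∀ j i, n + 1 ≤ j → j ≤ i →
      T' i = T' j * ∏ l ∈ Finset.Ioc j i, Polynomial.aeval (V l) (Pt l) := fun j i hj hi =>
    eq_mul_prod_Ioc' (u := fun l => Polynomial.aeval (V l) (Pt l)) hi fun l h1 _ => by
      simp only [Vge (l + 1) (by omega)]
      exact (h5 l (by omega)).2
  have hVn : V (n + 1) = zk := (Vge _ le_rfl).trans hY
  refine ⟨V, ?_, hVn, by rw [lowS n le_rfl, hT], by rw [upS _ le_rfl, hT']⟩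
  intro j i hj hi
  rcases Nat.lt_or_ge n i with hni | hni
  · rcases Nat.lt_or_ge n j with hnj | hnj
    · rw [upS i (by omega), upT j i (by omega) hj.le, next_of_pos _ (by omega), upS j (by omega)]
      ring
    · have e : T n * T' (n + 1) = Polynomial.aeval (V (n + 1)) (Pt (n + 1)) := by
        rw [hT, hT', hVn]; exact ht (by omega)
      have e2 : ∏ l ∈ Finset.Ioc j i, Polynomial.aeval (V l) (Pt l) =
          (∏ l ∈ Finset.Ioc j n, Polynomial.aeval (V l) (Pt l)) *
          Polynomial.aeval (V (n + 1)) (Pt (n + 1)) *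
          ∏ l ∈ Finset.Ioc (n + 1) i, Polynomial.aeval (V l) (Pt l) := by
        rw [← Finset.prod_Ioc_succ_top hnj]
        exact (Finset.prod_Ioc_consecutive _ (by omega) (by omega)).symm
      rw [upS i (by omega), upT (n + 1) i le_rfl (by omega), lowS j hnj, lowT j n hnj le_rfl, e2, ← e]
      ring
  · rw [lowS j (by omega), lowS i hni, lowT j i hj.le hni, next_of_pos _ (by omega : 0 < i)]
    ring

end Relations

/-! ### The surface as the solution set of the uniform relations -/

section Surface

variable {d : ℕ} {lam : ℕ → ℂ} {Pt : ℕ → Polynomial ℂ}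

theorem mem_surface_iff (h0 : lam 0 = 0) (p : Fin (d + 2) → ℂ) :
    p ∈ surface d lam Pt ↔ Rel d lam Pt (coord p) := by
  have e' : ∀ j i, j < i → (∏ k ∈ Finset.Ico (j + 1) i, (Pt k).eval (coord p k)) *
      (fullPoly lam Pt i).eval (coord p i) =
      shift lam (coord p) i * (∏ l ∈ Finset.Ioc j i, Polynomial.aeval (coord p l) (Pt l)) := by
    intro j i hj
    have : Finset.Ioc j i = Finset.Ico (j + 1) (i + 1) := by ext; simp
    rw [this, Finset.prod_Ico_succ_top (by omega)]
    simp [fullPoly, shift, Polynomial.coe_aeval_eq_eval]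
    ring
  constructor
  · rintro ⟨h1, h2⟩ j i hj hi
    rcases Nat.eq_zero_or_pos j with rfl | hj0
    · rw [next_zero, one_mul, ← e' 0 i hj, ← h1 i hj hi]
      simp [shift, h0]
    · have := h2 (j + 1) i (by omega) (by omega) hi
      rw [mul_assoc, e' j i hj] at this
      rw [next_of_pos _ hj0, mul_assoc, ← this]
      simp [shift]
  · intro h
    refine ⟨fun i h1 hi => ?_, fun j i hj hji hi => ?_⟩
    · have := h 0 i h1 hi
      rw [next_zero, one_mul, ← e' 0 i h1] at this
      rw [← this]
      simp [shift, h0]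
    · obtain ⟨j, rfl⟩ : ∃ k, j = k + 1 := ⟨j - 1, by omega⟩
      have := h j i (by omega) hi
      rw [next_of_pos _ (by omega), mul_assoc, ← e' j i (by omega)] at this
      rw [mul_assoc, ← this]
      simp [shift]

theorem coord_restrict (z : ℕ → ℂ) {k : ℕ} (hk : k ≤ d + 1) :
    coord (fun i : Fin (d + 2) => z i) k = z k := by
  simp [coord, Fin.ofNat, Nat.mod_eq_of_lt (by omega : k < d + 2)]

theorem restrict_mem_surface (h0 : lam 0 = 0) {z : ℕ → ℂ} (h : Rel d lam Pt z) :
    (fun i : Fin (d + 2) => z i) ∈ surface d lam Pt :=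
  (mem_surface_iff h0 _).2 (h.congr fun _ hi => coord_restrict z hi)

end Surface

end AffVar

namespace AffVar

/-! ### Density of the open set `z_0 ≠ 0` -/

section Density

variable {d : ℕ} {lam : ℕ → ℂ} {Pt : ℕ → Polynomial ℂ}

/-- The equalizer of the two projections of `ℂ × ℂ` admits division by a pair of equal nonzero
numbers, so `Rel.mem_of_le` applies. -/
theorem Rel.eq_of_le {z z' : ℕ → ℂ} (h : Rel d lam Pt z) (h' : Rel d lam Pt z') {i : ℕ}
    (hi : i ≤ d) (e1 : z i = z' i) (e2 : z (i + 1) = z' (i + 1)) (hne : z (i + 1) ≠ 0) :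
    ∀ l ≤ i + 1, z l = z' l :=
  (h.prod h').mem_of_le (AlgHom.equalizer (AlgHom.fst ℂ ℂ ℂ) (AlgHom.snd ℂ ℂ ℂ)) hi e1 e2
    fun q hq => by
      have hq : z (i + 1) * q.1 = z' (i + 1) * q.2 := hq
      rw [← e2] at hq
      exact mul_left_cancel₀ hne hq

theorem Rel.eq_of_ge {z z' : ℕ → ℂ} (h : Rel d lam Pt z) (h' : Rel d lam Pt z') {k : ℕ}
    (e1 : z k = z' k) (e2 : z (k + 1) = z' (k + 1)) (hne : shift lam z k ≠ 0) :
    ∀ l, k ≤ l → l ≤ d + 1 → z l = z' l :=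
  (h.prod h').mem_of_ge (AlgHom.equalizer (AlgHom.fst ℂ ℂ ℂ) (AlgHom.snd ℂ ℂ ℂ)) e1 e2
    fun q hq => by
      have hq : shift lam z k * q.1 = shift lam z' k * q.2 := hq
      have e : shift lam z' k = shift lam z k := by simp [shift, e1]
      rw [e] at hq
      exact mul_left_cancel₀ hne hq

/-- On a polynomial curve, a condition that forces `z_0` to be non-constant. -/
theorem Rel.zero_ne_zero {n : ℕ} {W : ℕ → Polynomial ℂ} (h0 : lam 0 = 0) (hPt : ∀ i, Pt i ≠ 0)
    (hW : Rel n lam Pt W) (hn : 1 ≤ n) (h1 : 1 ≤ (W n).natDegree) (h2 : W (n + 1) ≠ 0)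
    (h3 : (W (n + 1)).natDegree ≤ (W n).natDegree) : W 0 ≠ 0 := by
  have hshift : ∀ j, (shift lam W j).natDegree = (W j).natDegree := fun j => by
    simp only [shift, Polynomial.algebraMap_eq, Polynomial.natDegree_sub_C]
  have hne : ∀ j, 1 ≤ (W j).natDegree → Polynomial.aeval (W j) (Pt j) ≠ 0 := by
    intro j hj h
    rw [← Polynomial.comp_eq_aeval, Polynomial.comp_eq_zero_iff] at h
    rcases h with h | ⟨-, h⟩
    · exact hPt j h
    · rw [h, Polynomial.natDegree_C] at hj; omega
  have step : ∀ j < n, (∀ l, j < l → l ≤ n → 1 ≤ (W l).natDegree) →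
      shift lam W j ≠ 0 ∧ (next W j).natDegree ≤ (W j).natDegree := by
    intro j hj hl
    have e := hW j n hj le_rfl
    have hprod : ∏ l ∈ Finset.Ioc j n, Polynomial.aeval (W l) (Pt l) ≠ 0 :=
      Finset.prod_ne_zero_iff.2 fun l hl' =>
        hne l (hl l (Finset.mem_Ioc.1 hl').1 (Finset.mem_Ioc.1 hl').2)
    have hnext : next W j ≠ 0 := by
      rcases Nat.eq_zero_or_pos j with rfl | hj0
      · exact one_ne_zero
      · rw [next_of_pos _ hj0]
        intro h
        have := hl (j + 1) (by omega) (by omega)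
        rw [h] at this; simp at this
    have han : shift lam W n ≠ 0 := by
      intro h
      have := hshift n
      rw [h, Polynomial.natDegree_zero] at this; omega
    have hR := mul_ne_zero (mul_ne_zero hnext han) hprod
    have hj : shift lam W j ≠ 0 := by
      intro h; rw [h, zero_mul] at e; exact hR e.symm
    -- Degrees in the relation `(j, n)`: since `deg W_{n+1} ≤ deg W_n`, the degree of `W_j` is at
    -- least that of `next W j`. Nonconstancy thus descends from `n` to `1`.
    refine ⟨hj, ?_⟩
    have := congrArg Polynomial.natDegree e
    rw [Polynomial.natDegree_mul hj h2, Polynomial.natDegree_mul (mul_ne_zero hnext han) hprod,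
      Polynomial.natDegree_mul hnext han, hshift, hshift] at this
    omega
  have key : ∀ m < n, ∀ l, n - m ≤ l → l ≤ n → 1 ≤ (W l).natDegree := by
    intro m
    induction m with
    | zero =>
      intro _ l hl hl'
      obtain rfl : l = n := by omega
      exact h1
    | succ m ih =>
      intro hm l hl hl'
      by_cases hlm : n - m ≤ l
      · exact ih (by omega) l hlm hl'
      · have hs := (step l (by omega) fun l' h5 h6 => ih (by omega) l' (by omega) h6).2
        rw [next_of_pos _ (by omega)] at hs
        exact (ih (by omega) (l + 1) (by omega) (by omega)).trans hs
  have := (step 0 (by omega) fun l h5 h6 => key (n - 1) (by omega) l (by omega) h6).1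
  simpa [shift, h0] using this

/-- The curve on which `z_{n+1}` is a nonzero constant and `z_n` is the parameter. -/
theorem exists_line (h0 : lam 0 = 0) (hPt : ∀ i, Pt i ≠ 0) {n : ℕ} (hn : 1 ≤ n) {b : ℂ}
    (hb : b ≠ 0) : ∃ W : ℕ → Polynomial ℂ, Rel n lam Pt W ∧ W n = Polynomial.X ∧
      W (n + 1) = Polynomial.C b ∧ W 0 ≠ 0 := by
  -- Only the relations with `i ≤ n` are imposed, so the condition on `τ t` is void; `τ` is chosen
  -- to make `W n = X`.
  obtain ⟨W, hW, h1, h2, -⟩ := exists_chart (d := n) lam Pt n (Polynomial.C b)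
    (Polynomial.C b⁻¹ * (Polynomial.X - Polynomial.C (lam n))) 0 (by omega)
  have h3 : W n = Polynomial.X := by
    rw [next_of_pos _ hn, h1, ← mul_assoc, ← Polynomial.C_mul, mul_inv_cancel₀ hb,
      Polynomial.C_1, one_mul] at h2
    simpa [shift] using h2
  refine ⟨W, hW, h3, h1, hW.zero_ne_zero h0 hPt hn ?_ ?_ ?_⟩
  · simp [h3]
  · simpa [h1] using hb
  · simp [h1]

theorem Rel.eval {W : ℕ → Polynomial ℂ} (hW : Rel d lam Pt W) (u : ℂ) :
    Rel d lam Pt fun i => (W i).eval u := by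
  simpa [Polynomial.coe_aeval_eq_eval] using hW.map (Polynomial.aeval u : Polynomial ℂ →ₐ[ℂ] ℂ)

theorem aeval_eval (W : ℕ → Polynomial ℂ) (F : MvPolynomial (Fin (d + 2)) ℂ) (u : ℂ) :
    aeval (fun i : Fin (d + 2) => (W i).eval u) F =
      (aeval (fun i : Fin (d + 2) => W i) F : Polynomial ℂ).eval u := by
  have : (aeval (fun i : Fin (d + 2) => (W i).eval u) : MvPolynomial (Fin (d + 2)) ℂ →ₐ[ℂ] ℂ) =
      (Polynomial.aeval u : Polynomial ℂ →ₐ[ℂ] ℂ).comp (aeval fun i : Fin (d + 2) => W i) := by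
    ext i; simp [Polynomial.coe_aeval_eq_eval]
  rw [this]; simp [Polynomial.coe_aeval_eq_eval]

theorem aeval_eval_eq_zero {W : ℕ → Polynomial ℂ} {F : MvPolynomial (Fin (d + 2)) ℂ}
    {g : Polynomial ℂ} (hg : g ≠ 0)
    (h : ∀ u, g.eval u ≠ 0 → aeval (fun i : Fin (d + 2) => (W i).eval u) F = 0) (u : ℂ) :
    aeval (fun i : Fin (d + 2) => (W i).eval u) F = 0 := by
  have : g * aeval (fun i : Fin (d + 2) => W i) F = 0 := by
    refine Polynomial.funext fun u => ?_
    rw [Polynomial.eval_mul, ← aeval_eval, Polynomial.eval_zero]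
    by_cases hu : g.eval u = 0
    · rw [hu, zero_mul]
    · rw [h u hu, mul_zero]
  rw [aeval_eval, (mul_eq_zero.1 this).resolve_left hg, Polynomial.eval_zero]

theorem aeval_congr_seq (z z' : ℕ → ℂ) (h : ∀ l ≤ d + 1, z l = z' l)
    (F : MvPolynomial (Fin (d + 2)) ℂ) :
    aeval (fun i : Fin (d + 2) => z i) F = aeval (fun i : Fin (d + 2) => z' i) F := by
  congr 2; funext i; exact h i (by omega)

theorem Rel.next_mul_prod_eq_zero {z : ℕ → ℂ} (h : Rel d lam Pt z) {j m : ℕ} (hj : j < m)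
    (hm : m ≤ d) (hj0 : shift lam z j = 0) (hm0 : shift lam z m ≠ 0) :
    next z j * ∏ l ∈ Finset.Ioc j m, Polynomial.aeval (z l) (Pt l) = 0 := by
  have := h j m hj hm
  rw [hj0, zero_mul] at this
  have e : shift lam z m * (next z j * ∏ l ∈ Finset.Ioc j m, Polynomial.aeval (z l) (Pt l)) = 0 := by
    rw [this]; ring
  exact (mul_eq_zero.1 e).resolve_left hm0

/-- A point with `z_i = λ_i` for `i < m` moves in a family with parameter
`t = z_{m+1} / (z_m - λ_m)`. -/
theorem Rel.exists_deform {Q : Type*} [CommRing Q] [Algebra ℂ Q] {z : ℕ → ℂ}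
    (h : Rel d lam Pt z) {m : ℕ} (hm1 : 1 ≤ m) (hm : m ≤ d) (hlt : ∀ i < m, shift lam z i = 0)
    (hm0 : shift lam z m ≠ 0) (t : Q) :
    ∃ V : ℕ → Q, Rel d lam Pt V ∧ (∀ i ≤ m, V i = algebraMap ℂ Q (z i)) ∧
      V (m + 1) = algebraMap ℂ Q (shift lam z m) * t := by
  obtain ⟨Y, T, hY, hT, h5⟩ := exists_upper_chart lam Pt m (algebraMap ℂ Q (z m)) t
  set V : ℕ → Q := fun i => if i ≤ m then algebraMap ℂ Q (z i) else Y i with hV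
  have Vle : ∀ i ≤ m, V i = algebraMap ℂ Q (z i) := fun i hi => by simp [hV, hi]
  have Vge : ∀ i ≥ m, V i = Y i := by
    intro i hi
    rcases hi.eq_or_lt with rfl | h
    · simp [hV, hY]
    · simp [hV, show ¬ i ≤ m by omega]
  have sle : ∀ i ≤ m, shift lam V i = algebraMap ℂ Q (shift lam z i) := fun i hi => by
    simp [shift, Vle i hi]
  have upS : ∀ i ≥ m, V (i + 1) = shift lam V i * T i := by
    intro i hi
    have := (h5 i hi).1
    simp only [shift] at this ⊢
    rw [Vge i hi, Vge (i + 1) (by omega), this]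
  have upT : ∀ j i, m ≤ j → j ≤ i →
      T i = T j * ∏ l ∈ Finset.Ioc j i, Polynomial.aeval (V l) (Pt l) := fun j i hj hi =>
    eq_mul_prod_Ioc' (u := fun l => Polynomial.aeval (V l) (Pt l)) hi fun l h1 _ => by
      simp only [Vge (l + 1) (by omega)]
      exact (h5 l (by omega)).2
  refine ⟨V, ?_, Vle, by rw [upS m le_rfl, hT, sle m le_rfl]⟩
  intro j i hj hi
  rcases Nat.lt_or_ge j m with hjm | hjm
  · rw [sle j hjm.le, hlt j hjm, map_zero, zero_mul]
    rcases Nat.lt_or_ge i m with him | him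
    · rw [sle i him.le, hlt i him, map_zero, mul_zero, zero_mul]
    -- For `j < m < i` the left side is zero. The right side contains `next z j ∏_{j<l≤m}`, which
    -- vanishes at the given point and involves no coordinate beyond `z_m`.
    · have e := congrArg (algebraMap ℂ Q) (h.next_mul_prod_eq_zero hjm hm (hlt j hjm) hm0)
      rw [map_mul, map_prod, map_zero] at e
      have e1 : next V j = algebraMap ℂ Q (next z j) := by
        unfold next; split_ifs
        · simp
        · exact Vle _ hjm
      have e2 : ∏ l ∈ Finset.Ioc j m, Polynomial.aeval (V l) (Pt l) =
          ∏ l ∈ Finset.Ioc j m, algebraMap ℂ Q (Polynomial.aeval (z l) (Pt l)) :=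
        Finset.prod_congr rfl fun l hl => by
          rw [Vle l (Finset.mem_Ioc.1 hl).2, Polynomial.aeval_algebraMap_apply]
      rw [← Finset.prod_Ioc_consecutive _ hjm.le him, e1, e2]
      linear_combination (-shift lam V i *
        ∏ l ∈ Finset.Ioc m i, Polynomial.aeval (V l) (Pt l)) * e
  · rw [upS i (by omega), upT j i hjm hj.le, next_of_pos _ (by omega), upS j hjm]
    ring

/-- Two limits along polynomial curves. The point lies on its `t`-deformation; each member with `t ≠
0` lies on a curve with `t` fixed and `z_m` variable, on which `z_0` is not identically zero. -/
theorem Rel.aeval_eq_zero_of_shift_ne {z : ℕ → ℂ} (h0 : lam 0 = 0) (hPt : ∀ i, Pt i ≠ 0)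
    {F : MvPolynomial (Fin (d + 2)) ℂ}
    (hF : ∀ z : ℕ → ℂ, Rel d lam Pt z → z 0 ≠ 0 → aeval (fun i : Fin (d + 2) => z i) F = 0)
    (h : Rel d lam Pt z) {m : ℕ} (hm1 : 1 ≤ m) (hm : m ≤ d) (hlt : ∀ i < m, shift lam z i = 0)
    (hm0 : shift lam z m ≠ 0) : aeval (fun i : Fin (d + 2) => z i) F = 0 := by
  obtain ⟨V, hV, hV1, hV2⟩ := h.exists_deform hm1 hm hlt hm0 (Polynomial.X : Polynomial ℂ)
  have hVe : ∀ t, ∀ i ≤ m, (V i).eval t = z i := fun t i hi => by simp [hV1 i hi]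
  have hVe' : ∀ t, (V (m + 1)).eval t = shift lam z m * t := fun t => by simp [hV2]
  have key : ∀ t : ℂ, Polynomial.eval t Polynomial.X ≠ 0 →
      aeval (fun i : Fin (d + 2) => (V i).eval t) F = 0 := by
    intro t ht
    rw [Polynomial.eval_X] at ht
    obtain ⟨n, rfl⟩ : ∃ n, m = n + 1 := ⟨m - 1, by omega⟩
    -- For fixed `t ≠ 0` the chart equation `τ t = P̃_m(z_m)` is solved for `τ`, leaving `z_m` free.
    obtain ⟨W, hW, h1, -, h3⟩ := exists_chart (d := d) lam Pt n Polynomial.X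
      (Polynomial.C t⁻¹ * Polynomial.aeval Polynomial.X (Pt (n + 1))) (Polynomial.C t) fun _ => by
        rw [mul_comm, ← mul_assoc, ← Polynomial.C_mul, mul_inv_cancel₀ ht, Polynomial.C_1, one_mul]
    have hs : shift lam W (n + 1) = Polynomial.X - Polynomial.C (lam (n + 1)) := by
      simp [shift, h1]
    have hW0 : W 0 ≠ 0 := by
      refine (hW.mono hm).zero_ne_zero h0 hPt hm1 (by simp [h1]) ?_ ?_
      · rw [h3, hs]
        exact mul_ne_zero (Polynomial.X_sub_C_ne_zero _) (by simpa using ht)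
      · rw [h3, hs, h1, Polynomial.natDegree_mul_C ht]
        simp
    have hFW : ∀ u, (W 0).eval u ≠ 0 → aeval (fun i : Fin (d + 2) => (W i).eval u) F = 0 :=
      fun u hu => hF (fun i => (W i).eval u) (hW.eval u) hu
    have e := aeval_eval_eq_zero hW0 hFW (z (n + 1))
    have e1 : (V (n + 1)).eval t = (W (n + 1)).eval (z (n + 1)) := by
      simp [hVe t (n + 1) le_rfl, h1]
    have e2 : (V (n + 2)).eval t = (W (n + 2)).eval (z (n + 1)) := by
      rw [hVe', h3, hs]
      simp [shift]
    have e3 : shift lam (fun i => (V i).eval t) (n + 1) ≠ 0 := by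
      simpa [shift, hVe t (n + 1) le_rfl] using hm0
    refine (aeval_congr_seq (fun i => (V i).eval t) (fun i => (W i).eval (z (n + 1))) (fun l hl => ?_) F).trans e
    rcases Nat.lt_or_ge l (n + 1) with hl' | hl'
    · refine (hV.eval t).eq_of_le (hW.eval (z (n + 1))) hm e1 e2 ?_ l (by omega)
      simp only [hVe']
      exact mul_ne_zero hm0 ht
    · exact (hV.eval t).eq_of_ge (hW.eval (z (n + 1))) e1 e2 e3 l hl' hl
  refine (aeval_congr_seq z (fun i => (V i).eval (z (m + 1) / shift lam z m))
    (fun l hl => ?_) F).trans (aeval_eval_eq_zero (F := F) Polynomial.X_ne_zero key _)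
  rcases Nat.lt_or_ge l m with hl' | hl'
  · exact (hVe _ l hl'.le).symm
  · refine h.eq_of_ge (hV.eval _) (hVe _ m le_rfl).symm ?_ hm0 l hl' hl
    rw [hVe', mul_div_cancel₀ _ hm0]

/-- When `z_i = λ_i` for all `i ≤ d`, both sides of every relation vanish and `z_{d+1}` is free. For
`z_{d+1} ≠ 0` the point lies on a curve of `exists_line`; the value `0` is a limit. -/
theorem Rel.aeval_eq_zero_of_shift_eq {z : ℕ → ℂ} (h0 : lam 0 = 0) (hPt : ∀ i, Pt i ≠ 0)
    (hd : 1 ≤ d) {F : MvPolynomial (Fin (d + 2)) ℂ}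
    (hF : ∀ z : ℕ → ℂ, Rel d lam Pt z → z 0 ≠ 0 → aeval (fun i : Fin (d + 2) => z i) F = 0)
    (hz : ∀ i ≤ d, shift lam z i = 0) : aeval (fun i : Fin (d + 2) => z i) F = 0 := by
  obtain ⟨V, hVd⟩ : ∃ V : ℕ → Polynomial ℂ,
      V = fun i => if i ≤ d then Polynomial.C (lam i) else Polynomial.X := ⟨_, rfl⟩
  have hVs : ∀ i ≤ d, shift lam V i = 0 := fun i hi => by simp [shift, hVd, hi]
  have hV : Rel d lam Pt V := fun j i hj hi => by
    rw [hVs j (by omega), hVs i hi]; ring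
  have hVe : ∀ w, ∀ i ≤ d, (V i).eval w = lam i := fun w i hi => by simp [hVd, hi]
  have hVe' : ∀ w, (V (d + 1)).eval w = w := fun w => by simp [hVd]
  have key : ∀ w : ℂ, Polynomial.eval w Polynomial.X ≠ 0 →
      aeval (fun i : Fin (d + 2) => (V i).eval w) F = 0 := by
    intro w hw
    rw [Polynomial.eval_X] at hw
    obtain ⟨W, hW, h1, h2, hW0⟩ := exists_line h0 hPt hd hw
    have hFW : ∀ u, (W 0).eval u ≠ 0 → aeval (fun i : Fin (d + 2) => (W i).eval u) F = 0 :=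
      fun u hu => hF (fun i => (W i).eval u) (hW.eval u) hu
    refine (aeval_congr_seq (fun i => (V i).eval w) (fun i => (W i).eval (lam d)) (fun l hl => ?_) F).trans
      (aeval_eval_eq_zero hW0 hFW (lam d))
    refine (hV.eval w).eq_of_le (hW.eval (lam d)) le_rfl ?_ ?_ ?_ l hl
    · simp [hVe, h1]
    · simp [hVe', h2]
    · simpa [hVe'] using hw
  have e := aeval_eval_eq_zero Polynomial.X_ne_zero key (z (d + 1))
  refine (aeval_congr_seq z (fun i => (V i).eval (z (d + 1))) (fun l hl => ?_) F).trans e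
  rcases hl.eq_or_lt with rfl | hl
  · exact (hVe' _).symm
  · rw [hVe _ l (by omega)]
    simpa [shift, sub_eq_zero] using hz l (by omega)

/-- The open set `z_0 ≠ 0` is dense in the surface. -/
theorem Rel.aeval_eq_zero {z : ℕ → ℂ} (h0 : lam 0 = 0) (hPt : ∀ i, Pt i ≠ 0) (hd : 1 ≤ d)
    {F : MvPolynomial (Fin (d + 2)) ℂ}
    (hF : ∀ z : ℕ → ℂ, Rel d lam Pt z → z 0 ≠ 0 → aeval (fun i : Fin (d + 2) => z i) F = 0)
    (h : Rel d lam Pt z) : aeval (fun i : Fin (d + 2) => z i) F = 0 := by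
  classical
  by_cases hz0 : z 0 = 0
  · by_cases hex : ∃ m ≤ d, shift lam z m ≠ 0
    · have hs := Nat.find_spec hex
      refine h.aeval_eq_zero_of_shift_ne h0 hPt hF ?_ hs.1 (fun i hi => ?_) hs.2
      · by_contra hc
        have : Nat.find hex = 0 := by omega
        rw [this] at hs
        exact hs.2 (by simp [shift, hz0, h0])
      · by_contra hc
        exact Nat.find_min hex hi ⟨by omega, hc⟩
    · push Not at hex
      exact Rel.aeval_eq_zero_of_shift_eq h0 hPt hd hF hex
  · exact hF z h hz0

end Density

end AffVar

namespace AffVar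

/-! ### The chain of derivations at the generic point -/

section Derivations

variable {K : Type*} [Field K] [Algebra ℂ K]

/-- A derivation is the same as a ring map `a ↦ a + ε δ(a)` to the dual numbers. Nonzero elements of
`A` become units there, so the map extends to the fraction field. -/
theorem exists_derivation_extension {A : Type*} [CommRing A] [IsDomain A] [Algebra ℂ A]
    [Algebra A K] [IsFractionRing A K] [IsScalarTower ℂ A K] (δ : Derivation ℂ A K) :
    ∃ D : Derivation ℂ K K, ∀ a, D (algebraMap A K a) = δ a := by
  let f : A →+* TrivSqZeroExt K K :=
    { toFun := fun a => TrivSqZeroExt.inl (algebraMap A K a) + TrivSqZeroExt.inr (δ a)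
      map_one' := by simp
      map_zero' := by simp
      map_add' := fun a b => by ext <;> simp
      map_mul' := fun a b => by
        refine TrivSqZeroExt.ext ?_ ?_
        · simp
        · simp only [Derivation.leibniz, map_mul, TrivSqZeroExt.snd_add, TrivSqZeroExt.snd_mul,
            TrivSqZeroExt.snd_inl, TrivSqZeroExt.snd_inr, TrivSqZeroExt.fst_add,
            TrivSqZeroExt.fst_inl, TrivSqZeroExt.fst_inr, Algebra.smul_def,
            MulOpposite.smul_eq_mul_unop, MulOpposite.unop_op]
          simp
          ring }
  have hf : ∀ a : nonZeroDivisors A, IsUnit (f a) := fun a => by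
    rw [TrivSqZeroExt.isUnit_iff_isUnit_fst]
    simp [f]
  let g : K →+* TrivSqZeroExt K K := IsLocalization.lift (M := nonZeroDivisors A) hf
  have hg : ∀ a, g (algebraMap A K a) = f a := fun a => IsLocalization.lift_eq hf a
  have hfst : ∀ x, (g x).fst = x := by
    have : (TrivSqZeroExt.fstHom K K K : TrivSqZeroExt K K →+* K).comp g = RingHom.id K := by
      refine IsLocalization.ringHom_ext (nonZeroDivisors A) ?_
      ext a
      simp [hg, f]
    exact fun x => congrArg (fun h : K →+* K => h x) this
  have hc : ∀ c : ℂ, (g (algebraMap ℂ K c)).snd = 0 := fun c => by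
    rw [IsScalarTower.algebraMap_apply ℂ A K, hg]
    simp [f]
  have hmul : ∀ x y, (g (x * y)).snd = x * (g y).snd + y * (g x).snd := fun x y => by
    rw [map_mul, TrivSqZeroExt.snd_mul, hfst, hfst]
    simp [mul_comm]
  refine ⟨Derivation.mk'
    { toFun := fun x => (g x).snd
      map_add' := fun x y => by simp
      map_smul' := fun c x => by rw [Algebra.smul_def, hmul, hc]; simp [Algebra.smul_def] } fun x y => ?_, fun a => ?_⟩
  · exact hmul x y
  · simp [hg, f]

/-- Applying `D` to a polynomial relation for `x` gives one of smaller degree: an element moved by a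
derivation is transcendental over `ℂ`. -/
theorem aeval_ne_zero_of_derivation_ne_zero (D : Derivation ℂ K K) {x : K} (hx : D x ≠ 0)
    {q : Polynomial ℂ} (hq : q ≠ 0) : Polynomial.aeval x q ≠ 0 := by
  induction hn : q.natDegree using Nat.strong_induction_on generalizing q with
  | _ n ih =>
    intro h
    have h1 : Polynomial.aeval x (Polynomial.derivative q) = 0 := by
      have := congrArg D h
      rw [Derivation.map_aeval, map_zero, smul_eq_mul] at this
      exact (mul_eq_zero.1 this).resolve_right hx
    rcases Nat.eq_zero_or_pos n with h0 | h0
    · obtain ⟨c, rfl⟩ := Polynomial.natDegree_eq_zero.1 (hn.trans h0)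
      rw [Polynomial.aeval_C] at h
      exact hq (by simpa using h)
    · refine ih _ ?_ (fun h2 => ?_) rfl h1
      · rw [← hn]; exact Polynomial.natDegree_derivative_lt (by omega)
      · have := Polynomial.derivative_eq_zero.1 h2
        omega

variable {d : ℕ} {lam : ℕ → ℂ} {Pt : ℕ → Polynomial ℂ}

/-- `E` and `E'` are the two commuting logarithmic derivations of the chart
`(z_k, z_{k+1})`. -/
structure IsFrame (lam : ℕ → ℂ) (Z : ℕ → K) (k : ℕ) (E E' : Derivation ℂ K K) : Prop where
  next_ne : next Z k ≠ 0
  shift_ne : shift lam Z k ≠ 0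
  apply_self : E (Z k) = 0
  apply_succ : E (Z (k + 1)) = next Z k
  apply_succ' : E' (Z (k + 1)) = 0
  apply_self' : E' (Z k) = -shift lam Z k
  comm : ∀ x, E (E' x) = E' (E x)

theorem derivation_shift (D : Derivation ℂ K K) (Z : ℕ → K) (k : ℕ) :
    D (shift lam Z k) = D (Z k) := by
  simp [shift]

theorem derivation_aeval_eq_zero (D : Derivation ℂ K K) {x : K} (h : D x = 0)
    (q : Polynomial ℂ) : D (Polynomial.aeval x q) = 0 := by
  rw [Derivation.map_aeval, h, smul_zero]

theorem derivation_inv_eq_zero (D : Derivation ℂ K K) {x : K} (h : D x = 0) : D x⁻¹ = 0 := by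
  rw [Derivation.leibniz_inv, h, smul_zero]

theorem derivation_mul_eq_zero (D : Derivation ℂ K K) {x y : K} (h : D x = 0) (h' : D y = 0) :
    D (x * y) = 0 := by
  rw [Derivation.leibniz, h, h', smul_zero, smul_zero, add_zero]

theorem IsFrame.aeval_ne_zero {Z : ℕ → K} {k : ℕ} {E E' : Derivation ℂ K K}
    (h : IsFrame lam Z k E E') {q : Polynomial ℂ} (hq : q ≠ 0) :
    Polynomial.aeval (Z (k + 1)) q ≠ 0 :=
  aeval_ne_zero_of_derivation_ne_zero E (by rw [h.apply_succ]; exact h.next_ne) hq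

theorem IsFrame.shift_succ_ne {Z : ℕ → K} {k : ℕ} {E E' : Derivation ℂ K K}
    (h : IsFrame lam Z k E E') : shift lam Z (k + 1) ≠ 0 := by
  simpa [shift] using h.aeval_ne_zero (Polynomial.X_sub_C_ne_zero (lam (k + 1)))

/-- Relation `(k, k+1)` gives `E' z_{k+2} = z_{k+2}`. Subtracting a multiple of `E'` from `E` makes
it kill `z_{k+2}`, and the factor in front normalizes its value on `z_{k+1}`. Both coefficients are
constants of `E'`, so commutation survives. -/
theorem IsFrame.step (hPt : ∀ i, Pt i ≠ 0) {Z : ℕ → K} (hZ : Rel d lam Pt Z) {k : ℕ}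
    (hk : k + 1 ≤ d) {E E' : Derivation ℂ K K} (h : IsFrame lam Z k E E') :
    IsFrame lam Z (k + 1) E' (-(shift lam Z (k + 1) / next Z k) •
      (E - (E (Z (k + 2)) / Z (k + 2)) • E')) := by
  have hr : shift lam Z k * Z (k + 2) =
      next Z k * shift lam Z (k + 1) * Polynomial.aeval (Z (k + 1)) (Pt (k + 1)) := by
    simpa using hZ k (k + 1) (by omega) hk
  have h1 := h.shift_succ_ne
  have h2 : Z (k + 2) ≠ 0 := by
    intro h0
    rw [h0, mul_zero] at hr
    exact mul_ne_zero (mul_ne_zero h.next_ne h1) (h.aeval_ne_zero (hPt (k + 1))) hr.symm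
  have hn : E' (next Z k) = 0 := by
    unfold next; split_ifs
    · simp
    · exact h.apply_succ'
  have hs : E' (shift lam Z (k + 1)) = 0 := by rw [derivation_shift, h.apply_succ']
  have h3 : E' (Z (k + 2)) = Z (k + 2) := by
    have e := congrArg E' hr
    rw [derivation_mul_eq_zero E' (derivation_mul_eq_zero E' hn hs)
      (derivation_aeval_eq_zero E' h.apply_succ' _), Derivation.leibniz, derivation_shift,
      h.apply_self', smul_eq_mul, smul_eq_mul] at e
    refine mul_left_cancel₀ h.shift_ne ?_
    linear_combination e
  have hσ : E' (E (Z (k + 2)) / Z (k + 2)) = 0 := by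
    rw [div_eq_mul_inv, Derivation.leibniz, Derivation.leibniz_inv, ← h.comm, h3, smul_eq_mul,
      smul_eq_mul, smul_eq_mul]
    field_simp
    ring
  have hρ : E' (-(shift lam Z (k + 1) / next Z k)) = 0 := by
    rw [map_neg, div_eq_mul_inv, derivation_mul_eq_zero E' hs (derivation_inv_eq_zero E' hn),
      neg_zero]
  refine ⟨?_, h1, h.apply_succ', ?_, ?_, ?_, ?_⟩
  · rwa [next_of_pos _ (by omega)]
  · rw [next_of_pos _ (by omega), h3]
  · simp only [Derivation.smul_apply, Derivation.sub_apply, h3, smul_eq_mul]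
    rw [div_mul_cancel₀ _ h2, sub_self, mul_zero]
  · simp only [Derivation.smul_apply, Derivation.sub_apply, h.apply_succ, h.apply_succ',
      smul_eq_mul]
    rw [mul_zero, sub_zero, neg_mul, div_mul_cancel₀ _ h.next_ne]
  · intro x
    simp only [Derivation.smul_apply, Derivation.sub_apply, smul_eq_mul]
    rw [Derivation.leibniz, hρ, map_sub, Derivation.leibniz, hσ, h.comm]
    simp

theorem exists_frames (hPt : ∀ i, Pt i ≠ 0) {Z : ℕ → K} (hZ : Rel d lam Pt Z)
    {E E' : Derivation ℂ K K} (h : IsFrame lam Z 0 E E') :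
    ∃ D : ℕ → Derivation ℂ K K, D 0 = E ∧ D 1 = E' ∧
      ∀ k ≤ d, IsFrame lam Z k (D k) (D (k + 1)) := by
  let s : ℕ → Derivation ℂ K K × Derivation ℂ K K := Nat.rec (E, E') fun k s =>
    (s.2, -(shift lam Z (k + 1) / next Z k) • (s.1 - (s.1 (Z (k + 2)) / Z (k + 2)) • s.2))
  refine ⟨fun k => (s k).1, rfl, rfl, fun k hk => ?_⟩
  induction k with
  | zero => exact h
  | succ k ih => exact (ih (by omega)).step hPt hZ hk

theorem derivation_eq_zero_of_X {σ : Type*} [Algebra (MvPolynomial σ ℂ) K]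
    [IsScalarTower ℂ (MvPolynomial σ ℂ) K] [IsFractionRing (MvPolynomial σ ℂ) K]
    {D : Derivation ℂ K K} (h : ∀ i, D (algebraMap (MvPolynomial σ ℂ) K (X i)) = 0) : D = 0 := by
  have hA : ∀ a, D (algebraMap (MvPolynomial σ ℂ) K a) = 0 := by
    intro a
    induction a using MvPolynomial.induction_on with
    | C c =>
      rw [← MvPolynomial.algebraMap_eq, ← IsScalarTower.algebraMap_apply]
      exact D.map_algebraMap c
    | add p q hp hq => rw [map_add, map_add, hp, hq, add_zero]
    | mul_X p i hp => rw [map_mul, derivation_mul_eq_zero D hp (h i)]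
  ext w
  obtain ⟨a, b, -, rfl⟩ := IsFractionRing.div_surjective (A := MvPolynomial σ ℂ) w
  rw [div_eq_mul_inv, derivation_mul_eq_zero D (hA a) (derivation_inv_eq_zero D (hA b))]
  rfl

/-- The field `ℂ(x, y)` with a generic point of the surface. -/
theorem exists_generic_point (d : ℕ) (lam : ℕ → ℂ) (Pt : ℕ → Polynomial ℂ) (h0 : lam 0 = 0)
    (hPt : ∀ i, Pt i ≠ 0) :
    ∃ (Z : ℕ → FractionRing (MvPolynomial (Fin 2) ℂ)) (D : ℕ → Derivation ℂ
      (FractionRing (MvPolynomial (Fin 2) ℂ)) (FractionRing (MvPolynomial (Fin 2) ℂ))),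
      Rel d lam Pt Z ∧ Z 0 = algebraMap (MvPolynomial (Fin 2) ℂ) _ (X 0) ∧
      Z 1 = algebraMap (MvPolynomial (Fin 2) ℂ) _ (X 1) ∧
      ∀ k ≤ d, IsFrame lam Z k (D k) (D (k + 1)) := by
  set K := FractionRing (MvPolynomial (Fin 2) ℂ)
  set x : K := algebraMap (MvPolynomial (Fin 2) ℂ) K (X 0) with hx
  set y : K := algebraMap (MvPolynomial (Fin 2) ℂ) K (X 1) with hy
  have hx0 : x ≠ 0 := by
    rw [hx, Ne, IsFractionRing.to_map_eq_zero_iff]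
    exact X_ne_zero 0
  obtain ⟨Z, hZ, h1, h2, -⟩ := exists_chart (d := d) lam Pt 0 y x
    (x⁻¹ * Polynomial.aeval y (Pt 1)) fun _ => by rw [← mul_assoc, mul_inv_cancel₀ hx0, one_mul]
  have hZ0 : Z 0 = x := by simpa [shift, h0, next] using h2
  obtain ⟨δx, hdx⟩ := exists_derivation_extension (K := K)
    (mkDerivation ℂ (fun i : Fin 2 => if i = 0 then (1 : K) else 0))
  obtain ⟨δy, hdy⟩ := exists_derivation_extension (K := K)
    (mkDerivation ℂ (fun i : Fin 2 => if i = 0 then (0 : K) else 1))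
  have e1 : δx x = 1 := by rw [hx, hdx]; simp
  have e2 : δx y = 0 := by rw [hy, hdx]; simp
  have e3 : δy x = 0 := by rw [hx, hdy]; simp
  have e4 : δy y = 1 := by rw [hy, hdy]; simp
  have hcomm : ⁅δy, (-x) • δx⁆ = 0 := by
    refine derivation_eq_zero_of_X (σ := Fin 2) fun i => ?_
    rw [Derivation.commutator_apply]
    fin_cases i
    · change δy (((-x) • δx) x) - ((-x) • δx) (δy x) = 0
      simp [e1, e3]
    · change δy (((-x) • δx) y) - ((-x) • δx) (δy y) = 0
      simp [e2, e4]
  -- The chain starts with `∂/∂y` and `-x ∂/∂x`.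
  obtain ⟨D, -, -, hD⟩ := exists_frames (lam := lam) hPt hZ (E := δy) (E' := (-x) • δx)
    ⟨by simp [next], by simpa [shift, h0, hZ0] using hx0, by rw [hZ0, e3], by
      rw [h1, e4, next_zero], by simp [h1, e2], by simp [shift, h0, hZ0, e1], fun w => by
      have := congrArg (fun D : Derivation ℂ K K => D w) hcomm
      rw [Derivation.commutator_apply] at this
      exact sub_eq_zero.1 this⟩
  exact ⟨Z, D, hZ, hZ0, h1, hD⟩

end Derivations

end AffVar

namespace AffVar

/-! ### Bracket identities for two commuting derivations -/

section LieSubalgebras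

variable {K : Type*} [Field K] [Algebra ℂ K] {L : LieSubalgebra ℂ (Derivation ℂ K K)}
  {E F : Derivation ℂ K K}

theorem lie_smul_smul (h : ∀ x, E (F x) = F (E x)) (u v : K) :
    ⁅u • E, v • F⁆ = (u * E v) • F - (v * F u) • E := by
  ext w
  rw [Derivation.commutator_apply]
  simp only [Derivation.smul_apply, Derivation.sub_apply, Derivation.leibniz, smul_eq_mul, h]
  ring

theorem sub_smul_derivation (u v : K) : (u - v) • E = u • E - v • E := by
  ext w; simp [sub_mul]

theorem add_smul_derivation (u v : K) : (u + v) • E = u • E + v • E := by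
  ext w; simp [add_mul]

/-- In `[pE, [gE, fF]] - [pgE, E(f)F]` the `F`-components and the terms containing `E(f)` cancel. A
function `f` thereby moves from an `F`-field to an `E`-field. -/
theorem lie_triple_mem (h : ∀ x, E (F x) = F (E x)) {f g p : K} (hg : E g = 0)
    (hgL : g • E ∈ L) (hfL : f • F ∈ L) (hfL' : E f • F ∈ L) (hpL : p • E ∈ L)
    (hpgL : (p * g) • E ∈ L) : (f * F g * E p) • E ∈ L := by
  have h1 := L.sub_mem (L.lie_mem hpL (L.lie_mem hgL hfL)) (L.lie_mem hpgL hfL')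
  convert h1 using 1
  have hFg : E (F g) = 0 := by rw [h, hg, map_zero]
  rw [lie_smul_smul h, lie_smul_smul h, lie_sub, lie_smul_smul h, lie_smul_smul fun _ => rfl]
  ext w
  simp only [Derivation.smul_apply, Derivation.sub_apply, Derivation.leibniz, smul_eq_mul, hg, hFg]
  ring

/-- If `c B E ⊆ L` and `x ↦ f(x) F` are fields of `L`, then `c' B[x] E ⊆ L` for some
`c' ≠ 0`. -/
theorem exists_adjoin_smul_mem (h : ∀ x, E (F x) = F (E x)) {B : Subalgebra ℂ K}
    {c g s v x : K} {r : Polynomial ℂ} (hc : c ∈ B) (hc0 : c ≠ 0)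
    (hcL : ∀ b ∈ B, (c * b) • E ∈ L)
    (hgB : g ∈ B) (hg : E g = 0) (hgL : g • E ∈ L) (hFgB : F g ∈ B) (hFg0 : F g ≠ 0)
    (hsB : s ∈ B) (hs : E s = 0) (hs0 : s ≠ 0) (hsE : ∀ b ∈ B, s * E b ∈ B)
    (hvB : v ∈ B) (hv : E v = -v) (hv0 : v ≠ 0) (hr0 : Polynomial.aeval x r ≠ 0)
    (hrL : ∀ q, Polynomial.aeval x (r * q) • F ∈ L)
    (hrL' : ∀ q, E (Polynomial.aeval x (r * q)) • F ∈ L) :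
    ∃ c' ∈ B ⊔ Algebra.adjoin ℂ {x}, c' ≠ 0 ∧
      ∀ b ∈ B ⊔ Algebra.adjoin ℂ {x}, (c' * b) • E ∈ L := by
  have hEFg : E (F g) = 0 := by rw [h, hg, map_zero]
  have s1 : ∀ b ∈ B, ∀ q, (Polynomial.aeval x (r * q) * F g * E (c * b)) • E ∈ L :=
    fun b hb q => lie_triple_mem h hg hgL (hrL q) (hrL' q) (hcL b hb) (by
      rw [mul_assoc]; exact hcL _ (B.mul_mem hb hgB))
  -- The factor `s` clears the denominators that `E` introduces, so `φ` maps `B` to `B`.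
  let φ : K → K := fun b => F g * (s * E (c * b))
  have hφB : ∀ b ∈ B, φ b ∈ B := fun b hb => B.mul_mem hFgB (hsE _ (B.mul_mem hc hb))
  have hφL : ∀ b ∈ B, ∀ q, (Polynomial.aeval x (r * q) * φ b) • E ∈ L := by
    intro b hb q
    convert s1 (s * b) (B.mul_mem hsB hb) q using 2
    rw [show c * (s * b) = s * (c * b) by ring, E.leibniz s, hs]
    simp only [φ, smul_eq_mul]
    ring
  have s2 : ∀ b ∈ B, ∀ b' ∈ B, ∀ q,
      (F g * (c * b') * (2 * Polynomial.aeval x (r * q) * E (φ b) +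
        φ b * E (Polynomial.aeval x (r * q)))) • E ∈ L := by
    intro b hb b' hb' q
    have m1 := s1 (b' * φ b) (B.mul_mem hb' (hφB b hb)) q
    have m2 := L.lie_mem (hcL _ (B.mul_mem hFgB hb')) (hφL b hb q)
    rw [lie_smul_smul fun _ => rfl, ← sub_smul_derivation] at m2
    convert L.add_mem m1 m2 using 1
    rw [← add_smul_derivation]
    congr 1
    rw [show c * (b' * φ b) = (c * b') * φ b by ring,
      show c * (F g * b') = F g * (c * b') by ring]
    generalize φ b = y
    generalize c * b' = y'
    simp only [Derivation.leibniz, smul_eq_mul, hEFg]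
    ring
  -- Antisymmetrizing in `b`, `b₁` removes the term with `E(f)`, where `f = (rq)(x)`. What remains
  -- is `f` times an arbitrary element of `B` and a Wronskian of `φ b`, `φ b₁`.
  have s3 : ∀ b ∈ B, ∀ b₁ ∈ B, ∀ b' ∈ B, ∀ q,
      (2 * (F g * (c * b') * Polynomial.aeval x (r * q) * (φ b₁ * E (φ b) - φ b * E (φ b₁))))
        • E ∈ L := by
    intro b hb b₁ hb₁ b' hb' q
    convert L.sub_mem (s2 b hb (b' * φ b₁) (B.mul_mem hb' (hφB b₁ hb₁)) q)
      (s2 b₁ hb₁ (b' * φ b) (B.mul_mem hb' (hφB b hb)) q) using 1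
    rw [← sub_smul_derivation]
    congr 1
    ring
  have hvpow : ∀ i : ℕ, E (v ^ i) = -(i : K) * v ^ i := by
    intro i
    induction i with
    | zero => simp
    | succ i ih =>
      rw [pow_succ, E.leibniz, ih, hv]
      simp only [smul_eq_mul]; push_cast; ring
  have hφv : ∀ i : ℕ, φ (v ^ i) = F g * s * (v ^ i * (E c - i * c)) := by
    intro i
    simp only [φ, E.leibniz, smul_eq_mul, hvpow]
    ring
  have hEφv : ∀ i : ℕ, E (φ (v ^ i)) =
      F g * s * (v ^ i * (E (E c) - 2 * i * E c + i ^ 2 * c)) := by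
    intro i
    rw [hφv]
    simp only [E.leibniz, smul_eq_mul, hvpow, hEFg, hs, map_sub, E.map_natCast]
    ring
  -- Up to a nonzero factor, the Wronskian of consecutive powers of `v` is a quadratic polynomial in
  -- `i` with leading coefficient `c ^ 2`. Its second difference `2 c ^ 2` rules out vanishing at `i
  -- = 0, 1, 2`.
  obtain ⟨i, hi⟩ : ∃ i : ℕ, φ (v ^ (i + 1)) * E (φ (v ^ i)) - φ (v ^ i) * E (φ (v ^ (i + 1))) ≠ 0 := by
    by_contra hcon
    push Not at hcon
    have hD : ∀ i : ℕ, 2 * E c ^ 2 - (2 * i + 1) * E c * c - c * E (E c) + i * (i + 1) * c ^ 2 = 0 := by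
      intro i
      have e := hcon i
      rw [hEφv, hEφv, hφv, hφv] at e
      have hne : (F g * s) ^ 2 * (v ^ i * v ^ (i + 1)) ≠ 0 := by positivity
      refine (mul_eq_zero.1 (Eq.trans ?_ e)).resolve_left hne
      push_cast
      ring
    have e0 := hD 0
    have e1 := hD 1
    have e2 := hD 2
    push_cast at e0 e1 e2
    have : CharZero K := charZero_of_injective_algebraMap (algebraMap ℂ K).injective
    have : (2 : K) * c ^ 2 = 0 := by linear_combination e0 - 2 * e1 + e2
    simp [hc0] at this
  set w := φ (v ^ (i + 1)) * E (φ (v ^ i)) - φ (v ^ i) * E (φ (v ^ (i + 1))) with hw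
  have hswB : s * w ∈ B := by
    have e : s * w = φ (v ^ (i + 1)) * (s * E (φ (v ^ i))) - φ (v ^ i) * (s * E (φ (v ^ (i + 1)))) := by
      rw [hw]; ring
    have m := fun i : ℕ => hφB _ (B.pow_mem hvB i)
    rw [e]
    exact B.sub_mem (B.mul_mem (m _) (hsE _ (m _))) (B.mul_mem (m _) (hsE _ (m _)))
  have : CharZero K := charZero_of_injective_algebraMap (algebraMap ℂ K).injective
  have hBle : B ≤ B ⊔ Algebra.adjoin ℂ {x} := le_sup_left
  have hxle : Algebra.adjoin ℂ {x} ≤ B ⊔ Algebra.adjoin ℂ {x} := le_sup_right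
  refine ⟨2 * (F g * c) * (s * w) * Polynomial.aeval x r, ?_, ?_, fun b hb => ?_⟩
  · refine Subalgebra.mul_mem _ (Subalgebra.mul_mem _ (Subalgebra.mul_mem _ ?_ ?_) (hBle hswB))
      (hxle (Polynomial.aeval_mem_adjoin_singleton ℂ x))
    · exact ofNat_mem _ 2
    · exact hBle (B.mul_mem hFgB hc)
  · exact mul_ne_zero (mul_ne_zero (mul_ne_zero two_ne_zero (mul_ne_zero hFg0 hc0))
      (mul_ne_zero hs0 hi)) hr0
  · rw [← Subalgebra.mem_toSubmodule, ← Subalgebra.mul_toSubmodule] at hb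
    induction hb using Submodule.mul_induction_on' with
    | mem_mul_mem b hb y hy =>
      rw [Subalgebra.mem_toSubmodule, Algebra.adjoin_singleton_eq_range_aeval] at hy
      obtain ⟨q, hq⟩ := hy
      obtain rfl : Polynomial.aeval x q = y := hq
      convert s3 _ (B.pow_mem hvB i) _ (B.pow_mem hvB (i + 1)) (s * b) (B.mul_mem hsB hb) q using 2
      rw [map_mul]
      ring
    | add b _ b' _ h1 h2 => rw [mul_add, add_smul_derivation]; exact L.add_mem h1 h2

/-- In `[fF, uE] = f F(u) E - u E(f) F` the first term is already available once `c` divides `F(u)`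
in `B`. Taking `u = c (c s b)`, with one spare factor `c`, ensures this. -/
theorem exists_swap_smul_mem (h : ∀ x, E (F x) = F (E x)) {B : Subalgebra ℂ K}
    {c f s : K} (hc : c ∈ B) (hc0 : c ≠ 0) (hcL : ∀ b ∈ B, (c * b) • E ∈ L)
    (hfB : f ∈ B) (hfL : f • F ∈ L) (hEfB : E f ∈ B) (hEf0 : E f ≠ 0)
    (hsB : s ∈ B) (hs : F s = 0) (hs0 : s ≠ 0) (hsF : ∀ b ∈ B, s * F b ∈ B) :
    ∃ c' ∈ B, c' ≠ 0 ∧ ∀ b ∈ B, (c' * b) • F ∈ L := by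
  refine ⟨c * (c * s * E f), B.mul_mem hc (B.mul_mem (B.mul_mem hc hsB) hEfB),
    mul_ne_zero hc0 (mul_ne_zero (mul_ne_zero hc0 hs0) hEf0), fun b hb => ?_⟩
  have hu := hcL (c * s * b) (B.mul_mem (B.mul_mem hc hsB) hb)
  have m := L.lie_mem hfL hu
  rw [lie_smul_smul fun x => (h x).symm] at m
  have hFu : f * F (c * (c * s * b)) = c * (f * (2 * (s * F c) * b + c * (s * F b))) := by
    simp only [Derivation.leibniz, smul_eq_mul, hs]
    ring
  have m' := hcL (f * (2 * (s * F c) * b + c * (s * F b))) (B.mul_mem hfB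
    (B.add_mem (B.mul_mem (B.mul_mem (ofNat_mem _ 2) (hsF c hc)) hb)
      (B.mul_mem hc (hsF b hb))))
  rw [hFu] at m
  convert L.sub_mem m' m using 1
  rw [sub_sub_cancel]
  congr 1
  ring

/-- Start of the induction. For `p = p(x)` and `w = w(y)`, `[pF, y w E] - [p y F, w E] = p w E`,
because `F y = 1` and `E y = 0`. -/
theorem adjoin_sup_adjoin_smul_mem (h : ∀ x, E (F x) = F (E x)) {x y : K} {r r' : Polynomial ℂ}
    (hy : F y = 1) (hEy : E y = 0)
    (hL1 : ∀ q, Polynomial.aeval x (r * q) • F ∈ L)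
    (hL2 : ∀ q, (Polynomial.aeval x (r * q) * y) • F ∈ L)
    (hL3 : ∀ q, Polynomial.aeval y (r' * q) • E ∈ L) :
    ∀ b ∈ Algebra.adjoin ℂ {x} ⊔ Algebra.adjoin ℂ {y},
      (Polynomial.aeval x r * Polynomial.aeval y r' * b) • E ∈ L := by
  intro b hb
  rw [← Subalgebra.mem_toSubmodule, ← Subalgebra.mul_toSubmodule] at hb
  induction hb using Submodule.mul_induction_on' with
  | mem_mul_mem b hb b' hb' =>
    rw [Subalgebra.mem_toSubmodule, Algebra.adjoin_singleton_eq_range_aeval] at hb hb'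
    obtain ⟨q, hq⟩ := hb
    obtain rfl : Polynomial.aeval x q = b := hq
    obtain ⟨q', hq'⟩ := hb'
    obtain rfl : Polynomial.aeval y q' = b' := hq'
    have m := L.sub_mem (L.lie_mem (hL1 q) (hL3 (Polynomial.X * q')))
      (L.lie_mem (hL2 q) (hL3 q'))
    rw [lie_smul_smul fun x => (h x).symm, lie_smul_smul fun x => (h x).symm] at m
    convert m using 1
    have e1 : r' * (Polynomial.X * q') = Polynomial.X * (r' * q') := by ring
    rw [e1, map_mul (Polynomial.aeval y) Polynomial.X, Polynomial.aeval_X, F.leibniz y, hy,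
      E.leibniz _ y, hEy]
    ext w
    simp only [Derivation.smul_apply, Derivation.sub_apply, smul_eq_mul, map_mul]
    ring
  | add b _ b' _ h1 h2 => rw [mul_add, add_smul_derivation]; exact L.add_mem h1 h2

end LieSubalgebras

/-! ### Clearing the denominators of a derivation -/

section Regularization

variable {K : Type*} [Field K] [Algebra ℂ K]

/-- Elements that, together with their derivative, lie in `B` after multiplication by a power
of `h`. -/
def regularized (B : Subalgebra ℂ K) {h : K} (hh : h ∈ B) (E : Derivation ℂ K K) :
    Subalgebra ℂ K where
  carrier := {r | ∃ M : ℕ, h ^ M * r ∈ B ∧ h ^ M * E r ∈ B}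
  mul_mem' := by
    rintro a b ⟨M, h1, h2⟩ ⟨N, h3, h4⟩
    refine ⟨M + N, ?_, ?_⟩
    · convert B.mul_mem h1 h3 using 1; ring
    · convert B.add_mem (B.mul_mem h1 h4) (B.mul_mem h3 h2) using 1
      rw [E.leibniz, smul_eq_mul, smul_eq_mul]; ring
  add_mem' := by
    rintro a b ⟨M, h1, h2⟩ ⟨N, h3, h4⟩
    have hM := B.pow_mem hh M
    have hN := B.pow_mem hh N
    refine ⟨M + N, ?_, ?_⟩
    · convert B.add_mem (B.mul_mem hN h1) (B.mul_mem hM h3) using 1; ring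
    · convert B.add_mem (B.mul_mem hN h2) (B.mul_mem hM h4) using 1
      rw [map_add]; ring
  algebraMap_mem' := fun c => ⟨0, by simp, by simp⟩

theorem mem_regularized {B : Subalgebra ℂ K} {h : K} (hh : h ∈ B) {E : Derivation ℂ K K} {r : K}
    (hr : r ∈ B) (hEr : E r ∈ B) : r ∈ regularized B hh E := ⟨0, by simpa, by simpa⟩

/-- This is the division property required by `Rel.mem_of_le` and `Rel.mem_of_ge`; dividing by the
factor `h₁` of `h` costs one more power of `h`. -/
theorem mem_regularized_of_mul_mem {B : Subalgebra ℂ K} {h : K} (hh : h ∈ B)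
    {E : Derivation ℂ K K} {h₁ h₂ : K} (e : h = h₁ * h₂) (m₂ : h₂ ∈ B) (h1 : E h₁ = 0) {r : K}
    (hr : h₁ * r ∈ regularized B hh E) : r ∈ regularized B hh E := by
  obtain ⟨M, h3, h4⟩ := hr
  rw [E.leibniz, h1, smul_zero, add_zero, smul_eq_mul] at h4
  refine ⟨M + 1, ?_, ?_⟩
  · convert B.mul_mem m₂ h3 using 1; rw [pow_succ]; nth_rw 2 [e]; ring
  · convert B.mul_mem m₂ h4 using 1; rw [pow_succ]; nth_rw 2 [e]; ring

theorem exists_pow_mul_derivation_mem {s : Set K} (hs : s.Finite) {h : K}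
    (hh : h ∈ Algebra.adjoin ℂ s) {E : Derivation ℂ K K}
    (H : s ⊆ regularized (Algebra.adjoin ℂ s) hh E) :
    ∃ M : ℕ, ∀ b ∈ Algebra.adjoin ℂ s, h ^ M * E b ∈ Algebra.adjoin ℂ s := by
  choose! N hN using fun r (hr : r ∈ s) => H hr
  obtain ⟨M, hM⟩ := (hs.image N).bddAbove
  refine ⟨M, fun b hb => ?_⟩
  induction hb using Algebra.adjoin_induction with
  | mem r hr =>
    obtain ⟨k, hk⟩ := Nat.exists_eq_add_of_le (hM (Set.mem_image_of_mem N hr))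
    convert Subalgebra.mul_mem _ (Subalgebra.pow_mem _ hh k) (hN r hr).2 using 1
    rw [hk]; ring
  | algebraMap c => simp
  | add a b _ _ h1 h2 => rw [map_add, mul_add]; exact Subalgebra.add_mem _ h1 h2
  | mul a b ha hb h1 h2 =>
    convert Subalgebra.add_mem _ (Subalgebra.mul_mem _ ha h2) (Subalgebra.mul_mem _ hb h1) using 1
    rw [E.leibniz, smul_eq_mul, smul_eq_mul]; ring

end Regularization

end AffVar

namespace AffVar

/-! ### Induction along the chain of derivations -/

section LieInduction

variable {K : Type*} [Field K] [Algebra ℂ K] {L : LieSubalgebra ℂ (Derivation ℂ K K)}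
variable {d : ℕ} {lam : ℕ → ℂ} {Pt : ℕ → Polynomial ℂ} {Z : ℕ → K}

/-- The algebra `ℂ[z_0, …, z_k]`. -/
def coordAlg (Z : ℕ → K) (k : ℕ) : Subalgebra ℂ K := Algebra.adjoin ℂ (Z '' Set.Iic k)

theorem coordAlg_succ (Z : ℕ → K) (k : ℕ) :
    coordAlg Z (k + 1) = coordAlg Z k ⊔ Algebra.adjoin ℂ {Z (k + 1)} := by
  unfold coordAlg
  rw [← Algebra.adjoin_union, ← Set.image_singleton, ← Set.image_union]
  congr 2
  ext l; simp; omega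

theorem mem_coordAlg {k l : ℕ} (h : l ≤ k) : Z l ∈ coordAlg Z k :=
  Algebra.subset_adjoin ⟨l, h, rfl⟩

theorem Rel.exists_pow_mul_mem (hZ : Rel d lam Pt Z) {i : ℕ} (hi : i ≤ d)
    {E : Derivation ℂ K K} (h1 : E (Z (i + 1)) = 0) (h2 : E (Z i) ∈ coordAlg Z (i + 1)) :
    ∃ M : ℕ, ∀ b ∈ coordAlg Z (i + 1), Z (i + 1) ^ M * E b ∈ coordAlg Z (i + 1) := by
  have hh : Z (i + 1) ∈ coordAlg Z (i + 1) := mem_coordAlg le_rfl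
  refine exists_pow_mul_derivation_mem ((Set.finite_Iic _).image Z) hh ?_
  rintro _ ⟨l, hl, rfl⟩
  refine hZ.mem_of_le (regularized (coordAlg Z (i + 1)) hh E) hi
    (mem_regularized hh (mem_coordAlg (by omega)) h2)
    (mem_regularized hh hh (by rw [h1]; exact Subalgebra.zero_mem _)) (fun q hq => ?_) l hl
  exact mem_regularized_of_mul_mem hh (mul_one _).symm (Subalgebra.one_mem _) h1 hq

theorem derivation_aeval_mul_X_ne_zero (E : Derivation ℂ K K) {x : K} (hx : E x ≠ 0)
    {r : Polynomial ℂ} (hr : r ≠ 0) : E (Polynomial.aeval x (r * Polynomial.X)) ≠ 0 := by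
  rw [Derivation.map_aeval, smul_eq_mul]
  refine mul_ne_zero (aeval_ne_zero_of_derivation_ne_zero E hx fun h => ?_) hx
  have := Polynomial.derivative_eq_zero.1 h
  rw [Polynomial.natDegree_mul_X hr] at this
  omega

/-- `exists_adjoin_smul_mem` enlarges the coefficient ring of `E` by `z_{k+2}`, using the fields
`f(z_{k+2}) F`; then `exists_swap_smul_mem` passes from `E` to `F`. -/
theorem exists_good_succ (hZ : Rel d lam Pt Z) {E₀ E F : Derivation ℂ K K} {k : ℕ}
    (hk : k + 1 ≤ d) (hE : IsFrame lam Z k E₀ E) (hcomm : ∀ x, E (F x) = F (E x))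
    (hEZ : E (Z (k + 2)) = Z (k + 2)) (hZ0 : Z (k + 2) ≠ 0)
    (hF0 : F (Z (k + 2)) = 0) (hF1 : F (Z (k + 1)) ∈ coordAlg Z (k + 1))
    (hF2 : F (Z (k + 1)) ≠ 0) {r ρ : Polynomial ℂ} (hr : r ≠ 0) (hρ : ρ ≠ 0)
    (hrL : ∀ q, Polynomial.aeval (Z (k + 1)) (r * q) • E ∈ L)
    (hρL : ∀ q, Polynomial.aeval (Z (k + 2)) (ρ * q) • F ∈ L)
    (hgood : ∃ c ∈ coordAlg Z (k + 1), c ≠ 0 ∧ ∀ b ∈ coordAlg Z (k + 1), (c * b) • E ∈ L) :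
    (∃ c ∈ coordAlg Z (k + 2), c ≠ 0 ∧ ∀ b ∈ coordAlg Z (k + 2), (c * b) • E ∈ L) ∧
    ∃ c ∈ coordAlg Z (k + 2), c ≠ 0 ∧ ∀ b ∈ coordAlg Z (k + 2), (c * b) • F ∈ L := by
  obtain ⟨c, hc, hc0, hcL⟩ := hgood
  have hZk : Z (k + 1) ∈ coordAlg Z (k + 1) := mem_coordAlg le_rfl
  have hZk' : Z (k + 2) ∈ coordAlg Z (k + 2) := mem_coordAlg le_rfl
  have hle : coordAlg Z (k + 1) ≤ coordAlg Z (k + 2) :=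
    Algebra.adjoin_mono (Set.image_mono (Set.Iic_subset_Iic.2 (by omega)))
  have hZk0 : Z (k + 1) ≠ 0 := by simpa using hE.aeval_ne_zero Polynomial.X_ne_zero
  have hEZ0 : E (Z (k + 2)) ≠ 0 := by rwa [hEZ]
  obtain ⟨M, hM⟩ := hZ.exists_pow_mul_mem (E := E) (i := k) (by omega) hE.apply_succ' (by
    rw [hE.apply_self']
    exact neg_mem (shift_mem _ (mem_coordAlg (by omega))))
  obtain ⟨M', hM'⟩ := hZ.exists_pow_mul_mem (E := F) (i := k + 1) hk hF0 (hle hF1)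
  have hgood' : ∃ c ∈ coordAlg Z (k + 2), c ≠ 0 ∧ ∀ b ∈ coordAlg Z (k + 2), (c * b) • E ∈ L := by
    rw [coordAlg_succ Z (k + 1)]
    -- The square of `ρ` is taken because `E(f(z_{k+2}))` must remain divisible by `ρ` as well. The
    -- extra factor `X` in `g` makes it nonconstant, hence `F g ≠ 0`.
    refine exists_adjoin_smul_mem hcomm (g := Polynomial.aeval (Z (k + 1)) (r * Polynomial.X))
      (s := Z (k + 1) ^ M) (v := shift lam Z k) (r := ρ * ρ) hc hc0 hcL (aeval_mem _ hZk _)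
      (derivation_aeval_eq_zero E hE.apply_succ' _) (hrL _) ?_
      (derivation_aeval_mul_X_ne_zero F hF2 hr) (Subalgebra.pow_mem _ hZk M) ?_
      (pow_ne_zero _ hZk0) hM (shift_mem _ (mem_coordAlg (by omega)))
      (by rw [derivation_shift, hE.apply_self']) hE.shift_ne
      (aeval_ne_zero_of_derivation_ne_zero E hEZ0 (mul_ne_zero hρ hρ)) (fun q => ?_) fun q => ?_
    · rw [Derivation.map_aeval, smul_eq_mul]
      exact Subalgebra.mul_mem _ (aeval_mem _ hZk _) hF1
    · simpa using derivation_aeval_eq_zero E hE.apply_succ' (Polynomial.X ^ M)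
    · rw [mul_assoc]; exact hρL _
    · convert hρL ((Polynomial.derivative ρ * q * 2 + ρ * Polynomial.derivative q) *
        Polynomial.X) using 2
      rw [Derivation.map_aeval, hEZ, smul_eq_mul]
      simp only [Polynomial.derivative_mul, map_mul, map_add, map_ofNat, Polynomial.aeval_X]
      ring
  refine ⟨hgood', ?_⟩
  obtain ⟨c, hc, hc0, hcL⟩ := hgood'
  refine exists_swap_smul_mem hcomm hc hc0 hcL
    (f := Polynomial.aeval (Z (k + 2)) (ρ * Polynomial.X)) (s := Z (k + 2) ^ M')
    (aeval_mem _ hZk' _) (hρL _) ?_ (derivation_aeval_mul_X_ne_zero E hEZ0 hρ)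
    (Subalgebra.pow_mem _ hZk' M') ?_ (pow_ne_zero _ hZ0) hM'
  · rw [Derivation.map_aeval, smul_eq_mul, hEZ]
    exact Subalgebra.mul_mem _ (aeval_mem _ hZk' _) hZk'
  · simpa using derivation_aeval_eq_zero F hF0 (Polynomial.X ^ M')

/-- The derivation `D_{d+1}`, rescaled so that it multiplies `z_d - μ` instead of
`z_d - λ_d`. -/
noncomputable def recenter (lam : ℕ → ℂ) (Z : ℕ → K) (d : ℕ) (μ : ℂ) (E : Derivation ℂ K K) :
    Derivation ℂ K K :=
  ((Z d - algebraMap ℂ K μ) / shift lam Z d) • E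

theorem IsFrame.recenter_apply_self {E E' : Derivation ℂ K K} {k : ℕ}
    (h : IsFrame lam Z k E E') (μ : ℂ) :
    recenter lam Z k μ E' (Z k) = -(Z k - algebraMap ℂ K μ) := by
  rw [recenter, Derivation.smul_apply, h.apply_self', smul_eq_mul, mul_neg,
    div_mul_cancel₀ _ h.shift_ne]

theorem IsFrame.recenter_apply_succ {E E' : Derivation ℂ K K} {k : ℕ}
    (h : IsFrame lam Z k E E') (μ : ℂ) : recenter lam Z k μ E' (Z (k + 1)) = 0 := by
  rw [recenter, Derivation.smul_apply, h.apply_succ', smul_zero]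

theorem IsFrame.recenter_comm {E E' : Derivation ℂ K K} {k : ℕ}
    (h : IsFrame lam Z k E E') (μ : ℂ) (x : K) :
    E (recenter lam Z k μ E' x) = recenter lam Z k μ E' (E x) := by
  have : E ((Z k - algebraMap ℂ K μ) / shift lam Z k) = 0 := by
    rw [div_eq_mul_inv]
    refine derivation_mul_eq_zero E ?_ (derivation_inv_eq_zero E ?_)
    · simp [h.apply_self]
    · rw [derivation_shift, h.apply_self]
  simp only [recenter, Derivation.smul_apply, Derivation.leibniz, smul_eq_mul, this, h.comm]
  ring

theorem coordAlg_one (Z : ℕ → K) :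
    coordAlg Z 1 = Algebra.adjoin ℂ {Z 0} ⊔ Algebra.adjoin ℂ {Z 1} := by
  have h : coordAlg Z 0 = Algebra.adjoin ℂ {Z 0} := by
    unfold coordAlg
    rw [show Set.Iic 0 = {0} by ext; simp, Set.image_singleton]
  rw [← h]
  exact coordAlg_succ Z 0

theorem exists_good_one {E E' : Derivation ℂ K K} (hf : IsFrame lam Z 0 E E')
    {r : ℕ → Polynomial ℂ} (hr : ∀ k, r k ≠ 0)
    (h1 : ∀ q, Polynomial.aeval (Z 0) (r 0 * q) • E ∈ L)
    (h2 : ∀ q, (Polynomial.aeval (Z 0) (r 0 * q) * Z 1) • E ∈ L)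
    (h3 : ∀ q, Polynomial.aeval (Z 1) (r 1 * q) • E' ∈ L) :
    ∃ c ∈ coordAlg Z 1, c ≠ 0 ∧ ∀ b ∈ coordAlg Z 1, (c * b) • E' ∈ L := by
  have m0 : Z 0 ∈ coordAlg Z 1 := mem_coordAlg (by omega)
  have m1 : Z 1 ∈ coordAlg Z 1 := mem_coordAlg (by omega)
  refine ⟨Polynomial.aeval (Z 0) (r 0) * Polynomial.aeval (Z 1) (r 1),
    Subalgebra.mul_mem _ (aeval_mem _ m0 _) (aeval_mem _ m1 _), mul_ne_zero ?_
    (hf.aeval_ne_zero (hr 1)), fun b hb => ?_⟩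
  · exact aeval_ne_zero_of_derivation_ne_zero E'
      (by rw [hf.apply_self']; exact neg_ne_zero.2 hf.shift_ne) (hr 0)
  · rw [coordAlg_one] at hb
    exact adjoin_sup_adjoin_smul_mem (fun x => (hf.comm x).symm)
      (by rw [hf.apply_succ, next_zero]) hf.apply_succ' h1 h2 h3 b hb

/-- The step is repeated up to `D d`, and once more with the recentered last derivation as `F`. This
final step enlarges the ring to all of `ℂ[z_0, …, z_{d+1}]` for both derivations. -/
theorem exists_good (hd : 1 ≤ d) (hZ : Rel d lam Pt Z) {D : ℕ → Derivation ℂ K K}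
    (hD : ∀ k ≤ d, IsFrame lam Z k (D k) (D (k + 1))) {r : ℕ → Polynomial ℂ} (hr : ∀ k, r k ≠ 0)
    {μ : ℂ} (h1 : ∀ q, Polynomial.aeval (Z 0) (r 0 * q) • D 0 ∈ L)
    (h2 : ∀ q, (Polynomial.aeval (Z 0) (r 0 * q) * Z 1) • D 0 ∈ L)
    (h3 : ∀ k, 1 ≤ k → k ≤ d → ∀ q, Polynomial.aeval (Z k) (r k * q) • D k ∈ L)
    (h4 : ∀ q, Polynomial.aeval (Z (d + 1)) (r (d + 1) * q) •
      recenter lam Z d μ (D (d + 1)) ∈ L) :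
    (∃ c ∈ coordAlg Z (d + 1), c ≠ 0 ∧ ∀ b ∈ coordAlg Z (d + 1), (c * b) • D d ∈ L) ∧
    ∃ c ∈ coordAlg Z (d + 1), c ≠ 0 ∧
      ∀ b ∈ coordAlg Z (d + 1), (c * b) • recenter lam Z d μ (D (d + 1)) ∈ L := by
  have hmain : ∀ k, k + 1 ≤ d →
      ∃ c ∈ coordAlg Z (k + 1), c ≠ 0 ∧ ∀ b ∈ coordAlg Z (k + 1), (c * b) • D (k + 1) ∈ L := by
    intro k
    induction k with
    | zero => exact fun _ => exists_good_one (hD 0 (by omega)) hr h1 h2 (h3 1 le_rfl hd)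
    | succ k ih =>
      intro hk
      have hf := hD k (by omega)
      have hf' := hD (k + 1) (by omega)
      have e := hf'.apply_succ
      have e' := hf'.next_ne
      rw [next_of_pos _ (by omega)] at e e'
      refine (exists_good_succ hZ (by omega) hf hf'.comm e e' hf'.apply_succ' ?_ ?_ (hr (k + 1))
        (hr (k + 2)) (h3 (k + 1) (by omega) (by omega)) (h3 (k + 2) (by omega) hk)
        (ih (by omega))).2
      · rw [hf'.apply_self']
        exact neg_mem (shift_mem _ (mem_coordAlg le_rfl))
      · rw [hf'.apply_self']; exact neg_ne_zero.2 hf'.shift_ne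
  obtain ⟨k, rfl⟩ : ∃ k, d = k + 1 := ⟨d - 1, by omega⟩
  have hf := hD k (by omega)
  have hf' := hD (k + 1) (by omega)
  have e := hf'.apply_succ
  have e' := hf'.next_ne
  rw [next_of_pos _ (by omega)] at e e'
  refine exists_good_succ hZ le_rfl hf (hf'.recenter_comm μ) e e' (hf'.recenter_apply_succ μ) ?_
    ?_ (hr (k + 1)) (hr (k + 2)) (h3 (k + 1) (by omega) le_rfl) h4 (hmain k le_rfl)
  · rw [hf'.recenter_apply_self]
    exact neg_mem (sub_mem (mem_coordAlg le_rfl) (Subalgebra.algebraMap_mem _ _))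
  · rw [hf'.recenter_apply_self]
    refine neg_ne_zero.2 ?_
    simpa using hf.aeval_ne_zero (Polynomial.X_sub_C_ne_zero μ)

end LieInduction

end AffVar

namespace AffVar

/-! ### The coordinate ring of the surface -/

section CoordinateRing

variable {d : ℕ} {lam : ℕ → ℂ} {Pt : ℕ → Polynomial ℂ}

theorem evalAt_mk {σ : Type} {S : Set (σ → ℂ)} (p : S) (F : MvPolynomial σ ℂ) :
    evalAt p (Ideal.Quotient.mk _ F) = aeval (p : σ → ℂ) F := rfl

theorem coordRing_ext {σ : Type} {S : Set (σ → ℂ)} {f g : CoordRing S}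
    (h : ∀ p : S, evalAt p f = evalAt p g) : f = g := by
  obtain ⟨F, rfl⟩ := Ideal.Quotient.mk_surjective f
  obtain ⟨G, rfl⟩ := Ideal.Quotient.mk_surjective g
  rw [Ideal.Quotient.eq, mem_vanishingIdeal_iff]
  intro p hp
  have := h ⟨p, hp⟩
  rw [evalAt_mk, evalAt_mk] at this
  rw [map_sub, this, sub_self]

/-- The regular function `z_k` on the surface. -/
noncomputable def coordFun (d : ℕ) (lam : ℕ → ℂ) (Pt : ℕ → Polynomial ℂ) (k : ℕ) :
    CoordRing (surface d lam Pt) := Ideal.Quotient.mk _ (X (Fin.ofNat (d + 2) k))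

theorem evalAt_coordFun (p : surface d lam Pt) (k : ℕ) :
    evalAt p (coordFun d lam Pt k) = coord p.1 k := by
  rw [coordFun, evalAt_mk, aeval_X]; rfl

theorem coord_val (p : Fin (d + 2) → ℂ) (i : Fin (d + 2)) : coord p i = p i := by
  simp [coord]

theorem rel_coord (h0 : lam 0 = 0) (p : surface d lam Pt) : Rel d lam Pt (coord p.1) :=
  (mem_surface_iff h0 _).1 p.2

theorem rel_coordFun (h0 : lam 0 = 0) : Rel d lam Pt (coordFun d lam Pt) := by
  intro j i hj hi
  refine coordRing_ext fun p => ?_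
  have := rel_coord h0 p j i hj hi
  simp only [map_mul, map_prod, ← Polynomial.aeval_algHom_apply, ← shift_map, ← next_map,
    evalAt_coordFun]
  exact this

theorem adjoin_coordFun :
    Algebra.adjoin ℂ (coordFun d lam Pt '' Set.Iic (d + 1)) = ⊤ := by
  rw [eq_top_iff]
  rintro f -
  obtain ⟨F, rfl⟩ := Ideal.Quotient.mk_surjective f
  induction F using MvPolynomial.induction_on with
  | C c => exact Subalgebra.algebraMap_mem _ c
  | add F G hF hG => rw [map_add]; exact Subalgebra.add_mem _ hF hG
  | mul_X F i hF =>
    rw [map_mul]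
    refine Subalgebra.mul_mem _ hF (Algebra.subset_adjoin ⟨i, by simp; omega, ?_⟩)
    simp [coordFun]

theorem mem_of_coordFun_mem (S : Subalgebra ℂ (CoordRing (surface d lam Pt)))
    (h : ∀ k ≤ d + 1, coordFun d lam Pt k ∈ S) (f : CoordRing (surface d lam Pt)) : f ∈ S := by
  have : Algebra.adjoin ℂ (coordFun d lam Pt '' Set.Iic (d + 1)) ≤ S :=
    Algebra.adjoin_le (by rintro _ ⟨k, hk, rfl⟩; exact h k hk)
  rw [adjoin_coordFun] at this
  exact this trivial

end CoordinateRing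

/-! ### Embedding of the coordinate ring into the function field -/

section GenericPoint

variable {d : ℕ} {lam : ℕ → ℂ} {Pt : ℕ → Polynomial ℂ}
variable {K : Type*} [Field K] [Algebra ℂ K] [Algebra (MvPolynomial (Fin 2) ℂ) K]
  [IsScalarTower ℂ (MvPolynomial (Fin 2) ℂ) K]

theorem aeval_mem_of_forall {Q σ : Type*} [CommRing Q] [Algebra ℂ Q] (S : Subalgebra ℂ Q)
    {f : σ → Q} (h : ∀ i, f i ∈ S) (F : MvPolynomial σ ℂ) : aeval f F ∈ S := by
  induction F using MvPolynomial.induction_on with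
  | C c => rw [← MvPolynomial.algebraMap_eq, AlgHom.commutes]; exact S.algebraMap_mem c
  | add F G hF hG => rw [map_add]; exact S.add_mem hF hG
  | mul_X F i hF => rw [map_mul, aeval_X]; exact S.mul_mem hF (h i)

/-- Points of the surface with `z_0 ≠ 0`. -/
abbrev OpenPoint (d : ℕ) (lam : ℕ → ℂ) (Pt : ℕ → Polynomial ℂ) : Type :=
  {z : ℕ → ℂ // Rel d lam Pt z ∧ z 0 ≠ 0}

/-- Pairs of a rational function and a function on points that become the same polynomial in
`z_0, z_1` after multiplication by a power of `z_0`. -/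
def clearable (d : ℕ) (lam : ℕ → ℂ) (Pt : ℕ → Polynomial ℂ) (K : Type*) [Field K] [Algebra ℂ K]
    [Algebra (MvPolynomial (Fin 2) ℂ) K] [IsScalarTower ℂ (MvPolynomial (Fin 2) ℂ) K] :
    Subalgebra ℂ (K × (OpenPoint d lam Pt → ℂ)) where
  carrier := {u | ∃ (n : ℕ) (G : MvPolynomial (Fin 2) ℂ),
    algebraMap (MvPolynomial (Fin 2) ℂ) K (X 0) ^ n * u.1 =
      algebraMap (MvPolynomial (Fin 2) ℂ) K G ∧
    ∀ s : OpenPoint d lam Pt, s.1 0 ^ n * u.2 s = aeval ![s.1 0, s.1 1] G}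
  mul_mem' := by
    rintro u v ⟨n, G, h1, h2⟩ ⟨m, H, h3, h4⟩
    refine ⟨n + m, G * H, ?_, fun s => ?_⟩
    · rw [map_mul, ← h1, ← h3, Prod.fst_mul]; ring
    · rw [map_mul, ← h2, ← h4, Prod.snd_mul, Pi.mul_apply]; ring
  add_mem' := by
    rintro u v ⟨n, G, h1, h2⟩ ⟨m, H, h3, h4⟩
    refine ⟨n + m, X 0 ^ m * G + X 0 ^ n * H, ?_, fun s => ?_⟩
    · simp only [map_add, map_mul, map_pow, ← h1, ← h3, Prod.fst_add]; ring
    · simp only [map_add, map_mul, map_pow, ← h2, ← h4, Prod.snd_add, Pi.add_apply, aeval_X,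
        Matrix.cons_val_zero]; ring
  algebraMap_mem' := fun c => ⟨0, C c, by
      rw [← MvPolynomial.algebraMap_eq, ← IsScalarTower.algebraMap_apply]; simp, fun s => by
      rw [← MvPolynomial.algebraMap_eq, AlgHom.commutes]; simp⟩

theorem exists_clear (h0 : lam 0 = 0) {Z : ℕ → K} (hZ : Rel d lam Pt Z)
    (hx : Z 0 = algebraMap (MvPolynomial (Fin 2) ℂ) _ (X 0))
    (hy : Z 1 = algebraMap (MvPolynomial (Fin 2) ℂ) _ (X 1)) (F : MvPolynomial (Fin (d + 2)) ℂ) :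
    ∃ (n : ℕ) (G : MvPolynomial (Fin 2) ℂ),
      Z 0 ^ n * aeval (fun i : Fin (d + 2) => Z i) F = algebraMap (MvPolynomial (Fin 2) ℂ) K G ∧
      ∀ s : OpenPoint d lam Pt,
        s.1 0 ^ n * aeval (fun i : Fin (d + 2) => s.1 i) F = aeval ![s.1 0, s.1 1] G := by
  -- The generic point and all points with `z_0 ≠ 0` are treated as one solution, so that a single
  -- `n` and a single `G` serve both.
  let zz : ℕ → K × (OpenPoint d lam Pt → ℂ) := fun k => (Z k, fun s => s.1 k)
  have hzz : Rel d lam Pt zz := hZ.prod (Rel.pi fun s : OpenPoint d lam Pt => s.2.1)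
  have hs0 : shift lam zz 0 = zz 0 := by simp [shift, h0]
  have hm : ∀ l, 0 ≤ l → l ≤ d + 1 → zz l ∈ clearable d lam Pt K := by
    refine hzz.mem_of_ge _ ?_ ?_ fun q hq => ?_
    · exact ⟨0, X 0, by simp [zz, hx], fun s => by simp [zz]⟩
    · exact ⟨0, X 1, by simp [zz, hy], fun s => by simp [zz]⟩
    · rw [hs0] at hq
      obtain ⟨n, G, h1, h2⟩ := hq
      refine ⟨n + 1, G, ?_, fun s => ?_⟩
      · rw [← h1, Prod.fst_mul, show (zz 0).1 = Z 0 from rfl, hx]; ring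
      · rw [← h2, Prod.snd_mul, Pi.mul_apply]
        change _ = s.1 0 ^ n * (s.1 0 * q.2 s)
        ring
  obtain ⟨n, G, h1, h2⟩ := aeval_mem_of_forall (clearable d lam Pt K)
    (f := fun i : Fin (d + 2) => zz i) (fun i => hm i (Nat.zero_le _) (by omega)) F
  refine ⟨n, G, ?_, fun s => ?_⟩
  · rw [← h1, hx]
    congr 1
    exact (comp_aeval_apply (fun i : Fin (d + 2) => zz i)
      (AlgHom.fst ℂ K (OpenPoint d lam Pt → ℂ)) F).symm
  · rw [← h2]
    congr 1
    exact (comp_aeval_apply (fun i : Fin (d + 2) => zz i) ((Pi.evalAlgHom ℂ (fun _ => ℂ) s).comp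
      (AlgHom.snd ℂ K (OpenPoint d lam Pt → ℂ))) F).symm

theorem exists_openPoint (h0 : lam 0 = 0) {x : ℂ} (hx : x ≠ 0) (y : ℂ) :
    ∃ s : OpenPoint d lam Pt, s.1 0 = x ∧ s.1 1 = y := by
  obtain ⟨Z, hZ, h1, h2, -⟩ := exists_chart (d := d) lam Pt 0 y x
    (x⁻¹ * Polynomial.aeval y (Pt 1)) fun _ => by rw [← mul_assoc, mul_inv_cancel₀ hx, one_mul]
  have hZ0 : Z 0 = x := by simpa [shift, h0, next] using h2
  exact ⟨⟨Z, hZ, by rwa [hZ0]⟩, hZ0, h1⟩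

theorem aeval_generic_eq_zero_iff [FaithfulSMul (MvPolynomial (Fin 2) ℂ) K] (h0 : lam 0 = 0)
    {Z : ℕ → K} (hZ : Rel d lam Pt Z)
    (hx : Z 0 = algebraMap (MvPolynomial (Fin 2) ℂ) _ (X 0))
    (hy : Z 1 = algebraMap (MvPolynomial (Fin 2) ℂ) _ (X 1)) (F : MvPolynomial (Fin (d + 2)) ℂ) :
    aeval (fun i : Fin (d + 2) => Z i) F = 0 ↔
      ∀ z : ℕ → ℂ, Rel d lam Pt z → z 0 ≠ 0 → aeval (fun i : Fin (d + 2) => z i) F = 0 := by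
  obtain ⟨n, G, h1, h2⟩ := exists_clear h0 hZ hx hy F
  have hinj := FaithfulSMul.algebraMap_injective (MvPolynomial (Fin 2) ℂ) K
  constructor
  · intro h z hz hz0
    rw [h, mul_zero] at h1
    have hG : G = 0 := hinj (by rw [← h1, map_zero])
    have := h2 ⟨z, hz, hz0⟩
    rw [hG, map_zero] at this
    exact (mul_eq_zero.1 this).resolve_left (pow_ne_zero n hz0)
  · intro h
    -- Vanishing of `G` is known only off `v 0 = 0`; the factor `X 0` covers the rest.
    have hG : X 0 * G = 0 := by
      refine MvPolynomial.funext fun v => ?_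
      rw [map_mul, eval_X, map_zero]
      by_cases hv : v 0 = 0
      · rw [hv, zero_mul]
      · obtain ⟨s, hs0, hs1⟩ := exists_openPoint (d := d) (Pt := Pt) h0 hv (v 1)
        have := h2 s
        rw [h s.1 s.2.1 s.2.2, mul_zero, hs0, hs1] at this
        have e : ![v 0, v 1] = v := by ext i; fin_cases i <;> rfl
        rw [e, aeval_eq_eval] at this
        rw [← this, mul_zero]
    have hG : G = 0 := (mul_eq_zero.1 hG).resolve_left (X_ne_zero 0)
    rw [hG, map_zero] at h1
    refine (mul_eq_zero.1 h1).resolve_left (pow_ne_zero n ?_)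
    rw [hx]
    exact fun h => X_ne_zero (R := ℂ) (0 : Fin 2) (hinj (by rw [h, map_zero]))

/-- The embedding of `ℂ[S]` into the field of rational functions. -/
theorem exists_embedding [FaithfulSMul (MvPolynomial (Fin 2) ℂ) K] (h0 : lam 0 = 0)
    (hPt : ∀ i, Pt i ≠ 0) (hd : 1 ≤ d)
    {Z : ℕ → K} (hZ : Rel d lam Pt Z)
    (hx : Z 0 = algebraMap (MvPolynomial (Fin 2) ℂ) _ (X 0))
    (hy : Z 1 = algebraMap (MvPolynomial (Fin 2) ℂ) _ (X 1)) :
    ∃ ι : CoordRing (surface d lam Pt) →ₐ[ℂ] K, Function.Injective ι ∧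
      ∀ k ≤ d + 1, ι (coordFun d lam Pt k) = Z k := by
  refine ⟨Ideal.Quotient.liftₐ _ (aeval fun i : Fin (d + 2) => Z i) fun F hF => ?_, ?_, ?_⟩
  · exact (aeval_generic_eq_zero_iff h0 hZ hx hy F).2 fun z hz _ =>
      hF _ (restrict_mem_surface h0 hz)
  · rw [injective_iff_map_eq_zero]
    intro f hf
    obtain ⟨F, rfl⟩ := Ideal.Quotient.mk_surjective f
    have hF := (aeval_generic_eq_zero_iff h0 hZ hx hy F).1 hf
    rw [Ideal.Quotient.eq_zero_iff_mem]
    intro p hp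
    have := Rel.aeval_eq_zero h0 hPt hd hF (rel_coord h0 ⟨p, hp⟩)
    simpa only [coord_val] using this
  · intro k hk
    change aeval (fun i : Fin (d + 2) => Z i) (X (Fin.ofNat (d + 2) k)) = Z k
    rw [aeval_X]
    simp [Fin.ofNat, Nat.mod_eq_of_lt (by omega : k < d + 2)]

end GenericPoint

end AffVar

namespace AffVar

/-! ### Explicit entire integral curves -/

section Curves

variable {d : ℕ} {lam : ℕ → ℂ} {Pt : ℕ → Polynomial ℂ}

/-- `γ` is an integral curve of `θ`. -/
def IsIntegral {σ : Type} {S : Set (σ → ℂ)} (θ : VF S) (γ : ℂ → S) : Prop :=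
  ∀ (t : ℂ) (f : CoordRing S), HasDerivAt (fun s => evalAt (γ s) f) (evalAt (γ t) (θ f)) t

/-- The functions whose derivative along `γ` is given by `θ`. -/
def integralAlg {σ : Type} {S : Set (σ → ℂ)} (θ : VF S) (γ : ℂ → S) :
    Subalgebra ℂ (CoordRing S) where
  carrier := {f | ∀ t, HasDerivAt (fun s => evalAt (γ s) f) (evalAt (γ t) (θ f)) t}
  mul_mem' {f g} hf hg t := by
    simp only [map_mul, Derivation.leibniz, smul_eq_mul, map_add]
    exact ((hf t).fun_mul (hg t)).congr_deriv (by ring)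
  add_mem' {f g} hf hg t := by
    simp only [map_add]
    exact (hf t).fun_add (hg t)
  algebraMap_mem' c t := by
    simpa using hasDerivAt_const t c

/-- By the quotient rule, the integral-curve condition needs checking only on two consecutive
coordinates on the appropriate side; the recursions give the others. -/
theorem mem_integralAlg_of_mul_mem {σ : Type} {S : Set (σ → ℂ)} {θ : VF S} {γ : ℂ → S}
    {g f : CoordRing S} (hg : g ∈ integralAlg θ γ) (hg0 : ∀ t, evalAt (γ t) g ≠ 0)
    (hgf : g * f ∈ integralAlg θ γ) : f ∈ integralAlg θ γ := by
  intro t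
  have e : (fun s => evalAt (γ s) f) = fun s => evalAt (γ s) (g * f) / evalAt (γ s) g := by
    funext s
    rw [map_mul, mul_div_cancel_left₀ _ (hg0 s)]
  rw [e]
  refine ((hgf t).fun_div (hg t) (hg0 t)).congr_deriv ?_
  rw [Derivation.leibniz]
  simp only [map_mul, map_add, smul_eq_mul]
  have := hg0 t
  field_simp
  ring

theorem isIntegral_of_coordFun {θ : VF (surface d lam Pt)} {γ : ℂ → surface d lam Pt}
    (h : ∀ k ≤ d + 1, coordFun d lam Pt k ∈ integralAlg θ γ) : IsIntegral θ γ :=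
  fun t f => mem_of_coordFun_mem _ h f t

theorem evalAt_shift (p : surface d lam Pt) (k : ℕ) :
    evalAt p (shift lam (coordFun d lam Pt) k) = shift lam (coord p.1) k := by
  rw [← shift_map]; simp [shift, evalAt_coordFun]

theorem evalAt_aeval_coordFun (p : surface d lam Pt) (k : ℕ) (q : Polynomial ℂ) :
    evalAt p (Polynomial.aeval (coordFun d lam Pt k) q) = q.eval (coord p.1 k) := by
  rw [← Polynomial.aeval_algHom_apply, evalAt_coordFun, Polynomial.coe_aeval_eq_eval]

theorem surface_ext {p q : surface d lam Pt} (h : ∀ k ≤ d + 1, coord p.1 k = coord q.1 k) :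
    p = q := by
  apply Subtype.ext
  funext i
  have := h i (by omega)
  rwa [coord_val, coord_val] at this

theorem exists_curve_of_rel (h0 : lam 0 = 0) {Z : ℂ → ℕ → ℂ} (hZ : ∀ t, Rel d lam Pt (Z t)) :
    ∃ γ : ℂ → surface d lam Pt, ∀ t, ∀ k ≤ d + 1, coord (γ t).1 k = Z t k :=
  ⟨fun t => ⟨_, restrict_mem_surface h0 (hZ t)⟩, fun t _ hk => coord_restrict (Z t) hk⟩

theorem coordFun_mem_integralAlg {θ : VF (surface d lam Pt)} {γ : ℂ → surface d lam Pt} {k : ℕ}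
    {φ : ℂ → ℂ} (hφ : ∀ t, coord (γ t).1 k = φ t)
    (h : ∀ t, HasDerivAt φ (evalAt (γ t) (θ (coordFun d lam Pt k))) t) :
    coordFun d lam Pt k ∈ integralAlg θ γ := by
  intro t
  simpa only [evalAt_coordFun, hφ] using h t

theorem hasDerivAt_exp_mul (c a t : ℂ) :
    HasDerivAt (fun s => a * Complex.exp (c * s)) (c * (a * Complex.exp (c * t))) t := by
  have h := (((hasDerivAt_id t).const_mul c).cexp).const_mul a
  simp only [id, mul_one] at h
  exact h.congr_deriv (by ring)

/-- Integral curves in the chart with coordinate `z_{n+1}`. -/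
theorem exists_integral_curve (h0 : lam 0 = 0) {θ : VF (surface d lam Pt)} {n : ℕ}
    (hn : n + 1 ≤ d) {ρ : Polynomial ℂ} (h1 : θ (coordFun d lam Pt (n + 1)) = 0)
    (h2 : θ (coordFun d lam Pt n) = -(Polynomial.aeval (coordFun d lam Pt (n + 1)) ρ *
      shift lam (coordFun d lam Pt) n))
    (h3 : θ (coordFun d lam Pt (n + 2)) = Polynomial.aeval (coordFun d lam Pt (n + 1)) ρ *
      coordFun d lam Pt (n + 2))
    (p : surface d lam Pt) (hp : coord p.1 (n + 1) ≠ 0)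
    (hp' : shift lam (coord p.1) (n + 1) ≠ 0) :
    ∃ γ : ℂ → surface d lam Pt, γ 0 = p ∧ IsIntegral θ γ ∧
      (∀ t, coord (γ t).1 (n + 1) = coord p.1 (n + 1)) ∧
      ∀ t, coord (γ t).1 n = lam n + shift lam (coord p.1) n *
        Complex.exp (-ρ.eval (coord p.1 (n + 1)) * t) := by
  set z := coord p.1 with hz
  have hrel := rel_coord h0 p
  set κ := z (n + 1) with hκ
  set F := ρ.eval κ with hF
  have hnx : next z n ≠ 0 := by
    unfold next; split_ifs
    exacts [one_ne_zero, hp]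
  -- The two chart parameters are scaled by inverse exponentials, which preserves their product and
  -- hence the chart equation.
  have hchart : ∀ t : ℂ, ∃ Z : ℕ → ℂ, Rel d lam Pt Z ∧ Z (n + 1) = κ ∧
      shift lam Z n = next Z n * (shift lam z n / next z n * Complex.exp (-F * t)) ∧
      Z (n + 2) = shift lam Z (n + 1) *
        (z (n + 2) / shift lam z (n + 1) * Complex.exp (F * t)) := by
    intro t
    refine exists_chart lam Pt n κ _ _ fun _ => ?_
    have e := hrel n (n + 1) (by omega) hn
    have e2 : Complex.exp (-F * t) * Complex.exp (F * t) = 1 := by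
      rw [← Complex.exp_add]; simp
    have e3 : Finset.Ioc n (n + 1) = {n + 1} := by ext; simp
    rw [e3, Finset.prod_singleton] at e
    calc _ = shift lam z n * z (n + 2) / (next z n * shift lam z (n + 1)) *
          (Complex.exp (-F * t) * Complex.exp (F * t)) := by field_simp
      _ = _ := by rw [e2, e]; field_simp; rfl
  choose Z hZ hZ1 hZ2 hZ3 using hchart
  obtain ⟨γ, hγ⟩ := exists_curve_of_rel h0 hZ
  have hnext : ∀ t, next (Z t) n = next z n := fun t => by
    unfold next; split_ifs
    exacts [rfl, hZ1 t]
  have hsh : ∀ t, shift lam (Z t) (n + 1) = shift lam z (n + 1) := fun t => by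
    simp [shift, hZ1 t, ← hκ]
  have c1 : ∀ t, coord (γ t).1 (n + 1) = κ := fun t => by rw [hγ t _ (by omega), hZ1]
  have c0 : ∀ t, coord (γ t).1 n = lam n + shift lam z n * Complex.exp (-F * t) := fun t => by
    have e := hZ2 t
    rw [hnext, ← mul_assoc, mul_div_cancel₀ _ hnx] at e
    rw [hγ t _ (by omega), ← e]
    simp [shift]
  have c2 : ∀ t, coord (γ t).1 (n + 2) = z (n + 2) * Complex.exp (F * t) := fun t => by
    rw [hγ t _ (by omega), hZ3, hsh, ← mul_assoc, mul_div_cancel₀ _ hp']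
  refine ⟨γ, ?_, isIntegral_of_coordFun fun k hk => ?_, c1, c0⟩
  · have e0 : coord (γ 0).1 n = z n := by rw [c0]; simp [shift]
    have e1 : coord (γ 0).1 (n + 2) = z (n + 2) := by rw [c2]; simp
    refine surface_ext fun k hk => ?_
    rcases Nat.lt_or_ge k (n + 1) with hk' | hk'
    · exact (rel_coord h0 (γ 0)).eq_of_le hrel (by omega) e0 (c1 0) (by rw [c1]; exact hp) k
        (by omega)
    · refine (rel_coord h0 (γ 0)).eq_of_ge hrel (c1 0) e1 ?_ k hk' hk
      simpa [shift, c1] using hp'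
  · have m1 : coordFun d lam Pt (n + 1) ∈ integralAlg θ γ :=
      coordFun_mem_integralAlg c1 fun t => by
        rw [h1, map_zero]; exact hasDerivAt_const t κ
    have m0 : coordFun d lam Pt n ∈ integralAlg θ γ :=
      coordFun_mem_integralAlg c0 fun t => by
        rw [h2, map_neg, map_mul, evalAt_aeval_coordFun, evalAt_shift, c1]
        refine ((hasDerivAt_exp_mul (-F) (shift lam z n) t).const_add (lam n)).congr_deriv ?_
        simp [shift, c0, hF]
    have m2 : coordFun d lam Pt (n + 2) ∈ integralAlg θ γ :=
      coordFun_mem_integralAlg c2 fun t => by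
        rw [h3, map_mul, evalAt_aeval_coordFun, evalAt_coordFun, c1, c2]
        exact hasDerivAt_exp_mul F (z (n + 2)) t
    rcases Nat.lt_or_ge k (n + 1) with hk' | hk'
    · refine (rel_coordFun h0).mem_of_le _ (by omega) m0 m1 (fun q hq => ?_) k (by omega)
      exact mem_integralAlg_of_mul_mem m1 (fun t => by rw [evalAt_coordFun, c1]; exact hp) hq
    · refine (rel_coordFun h0).mem_of_ge _ m1 m2 (fun q hq => ?_) k hk' hk
      refine mem_integralAlg_of_mul_mem (shift_mem _ m1) (fun t => ?_) hq
      rw [evalAt_shift]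
      simpa [shift, c1] using hp'

/-- Integral curves in the chart with coordinate `z_{d+1} ≠ 0`. -/
theorem exists_integral_curve_last (h0 : lam 0 = 0) (hd : 1 ≤ d) {θ : VF (surface d lam Pt)}
    {ρ : Polynomial ℂ} {μ : ℂ} (h1 : θ (coordFun d lam Pt (d + 1)) = 0)
    (h2 : θ (coordFun d lam Pt d) = -(Polynomial.aeval (coordFun d lam Pt (d + 1)) ρ *
      (coordFun d lam Pt d - algebraMap ℂ _ μ)))
    (p : surface d lam Pt) (hp : coord p.1 (d + 1) ≠ 0) :
    ∃ γ : ℂ → surface d lam Pt, γ 0 = p ∧ IsIntegral θ γ ∧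
      (∀ t, coord (γ t).1 (d + 1) = coord p.1 (d + 1)) ∧
      ∀ t, coord (γ t).1 d = μ + (coord p.1 d - μ) *
        Complex.exp (-ρ.eval (coord p.1 (d + 1)) * t) := by
  set z := coord p.1 with hz
  have hrel := rel_coord h0 p
  set κ := z (d + 1) with hκ
  set F := ρ.eval κ with hF
  have hchart : ∀ t : ℂ, ∃ Z : ℕ → ℂ, Rel d lam Pt Z ∧ Z (d + 1) = κ ∧
      shift lam Z d = next Z d * ((μ + (z d - μ) * Complex.exp (-F * t) - lam d) / κ) := by
    intro t
    -- The index `d + 1` is out of range for the chart equation, so the second parameter is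
    -- immaterial and is set to `0`.
    obtain ⟨Z, hZ, e1, e2, -⟩ := exists_chart (d := d) lam Pt d κ
      ((μ + (z d - μ) * Complex.exp (-F * t) - lam d) / κ) 0 (by omega)
    exact ⟨Z, hZ, e1, e2⟩
  choose Z hZ hZ1 hZ2 using hchart
  obtain ⟨γ, hγ⟩ := exists_curve_of_rel h0 hZ
  have c1 : ∀ t, coord (γ t).1 (d + 1) = κ := fun t => by rw [hγ t _ (by omega), hZ1]
  have c0 : ∀ t, coord (γ t).1 d = μ + (z d - μ) * Complex.exp (-F * t) := fun t => by
    have e := hZ2 t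
    rw [next_of_pos _ hd, hZ1, mul_div_cancel₀ _ hp] at e
    rw [hγ t _ (by omega)]
    simpa [shift] using e
  refine ⟨γ, ?_, isIntegral_of_coordFun fun k hk => ?_, c1, c0⟩
  · refine surface_ext fun k hk => ?_
    refine (rel_coord h0 (γ 0)).eq_of_le hrel le_rfl ?_ (c1 0) (by rw [c1]; exact hp) k hk
    rw [c0]; simp [← hz]
  · have m1 : coordFun d lam Pt (d + 1) ∈ integralAlg θ γ :=
      coordFun_mem_integralAlg c1 fun t => by
        rw [h1, map_zero]; exact hasDerivAt_const t κ
    have m0 : coordFun d lam Pt d ∈ integralAlg θ γ :=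
      coordFun_mem_integralAlg c0 fun t => by
        rw [h2, map_neg, map_mul, evalAt_aeval_coordFun, map_sub, evalAt_coordFun, c1, c0,
          AlgHom.commutes]
        refine ((hasDerivAt_exp_mul (-F) (z d - μ) t).const_add μ).congr_deriv ?_
        simp [← hF]
    refine (rel_coordFun h0).mem_of_le _ le_rfl m0 m1 (fun q hq => ?_) k hk
    exact mem_integralAlg_of_mul_mem m1 (fun t => by rw [evalAt_coordFun, c1]; exact hp) hq

/-- Integral curves in the chart `z_0 ≠ 0`. -/
theorem exists_integral_curve_zero (h0 : lam 0 = 0) {θ : VF (surface d lam Pt)}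
    (h1 : θ (coordFun d lam Pt 0) = 0)
    (p : surface d lam Pt) (hp : coord p.1 0 ≠ 0) {φ : ℂ → ℂ} (hφ0 : φ 0 = coord p.1 1)
    (hφ : ∀ t, ∀ q : surface d lam Pt, coord q.1 0 = coord p.1 0 → coord q.1 1 = φ t →
      HasDerivAt φ (evalAt q (θ (coordFun d lam Pt 1))) t) :
    ∃ γ : ℂ → surface d lam Pt, γ 0 = p ∧ IsIntegral θ γ ∧
      (∀ t, coord (γ t).1 0 = coord p.1 0) ∧ ∀ t, coord (γ t).1 1 = φ t := by
  have hex : ∀ t, ∃ s : OpenPoint d lam Pt, s.1 0 = coord p.1 0 ∧ s.1 1 = φ t :=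
    fun t => exists_openPoint h0 hp (φ t)
  choose s hs0 hs1 using hex
  obtain ⟨γ, hγ⟩ := exists_curve_of_rel h0 fun t => (s t).2.1
  have c0 : ∀ t, coord (γ t).1 0 = coord p.1 0 := fun t => by rw [hγ t _ (by omega), hs0]
  have c1 : ∀ t, coord (γ t).1 1 = φ t := fun t => by rw [hγ t _ (by omega), hs1]
  have hs : ∀ q : surface d lam Pt, shift lam (coord q.1) 0 = coord q.1 0 := fun q => by
    simp [shift, h0]
  refine ⟨γ, ?_, isIntegral_of_coordFun fun k hk => ?_, c0, c1⟩
  · refine surface_ext fun k hk => ?_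
    exact (rel_coord h0 (γ 0)).eq_of_ge (rel_coord h0 p) (c0 0) ((c1 0).trans hφ0)
      (by rw [hs, c0]; exact hp) k (Nat.zero_le _) hk
  · have m0 : coordFun d lam Pt 0 ∈ integralAlg θ γ :=
      coordFun_mem_integralAlg c0 fun t => by
        rw [h1, map_zero]; exact hasDerivAt_const t _
    have m1 : coordFun d lam Pt 1 ∈ integralAlg θ γ :=
      coordFun_mem_integralAlg c1 fun t => hφ t (γ t) (c0 t) (c1 t)
    refine (rel_coordFun h0).mem_of_ge _ m0 m1 (fun q hq => ?_) k (Nat.zero_le _) hk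
    exact mem_integralAlg_of_mul_mem (shift_mem _ m0)
      (fun t => by rw [evalAt_shift, hs, c0]; exact hp) hq

/-- The zero set of an ideal stable under `θ` is invariant under integral curves of `θ`. -/
theorem IsIntegral.eq_zero {σ : Type} {S : Set (σ → ℂ)} {θ : VF S} {γ : ℂ → S}
    (hγ : IsIntegral θ γ) {T : Ideal (CoordRing S)} (hT : ∀ f ∈ T, θ f ∈ T)
    (h : ∀ f ∈ T, evalAt (γ 0) f = 0) {f : CoordRing S} (hf : f ∈ T) (t : ℂ) :
    evalAt (γ t) f = 0 := by
  have hdiff : Differentiable ℂ fun s => evalAt (γ s) f := fun s => (hγ s f).differentiableAt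
  -- The `n`-th derivative along `γ` is `θ^n f`, again in `T`; so all Taylor coefficients at `0` of
  -- this entire function vanish.
  have hiter : ∀ n : ℕ, ∀ f ∈ T, iteratedDeriv n (fun s => evalAt (γ s) f) 0 = 0 := by
    intro n
    induction n with
    | zero => intro f hf; simpa using h f hf
    | succ n ih =>
      intro f hf
      rw [iteratedDeriv_succ', show deriv (fun s => evalAt (γ s) f) =
        fun s => evalAt (γ s) (θ f) from funext fun s => (hγ s f).deriv]
      exact ih _ (hT f hf)
  have := Complex.taylorSeries_eq_of_entire' 0 t hdiff
  rw [← this]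
  simp [hiter _ f hf]

end Curves

end AffVar

namespace AffVar

/-! ### Derivations of `ℂ[S]` as derivations of the function field -/

section Lifts

variable {R K : Type*} [CommRing R] [Algebra ℂ R] [Field K] [Algebra ℂ K]

/-- The derivation `E` extends the derivation `θ` along `ι`. -/
def Lifts (ι : R →ₐ[ℂ] K) (θ : Derivation ℂ R R) (E : Derivation ℂ K K) : Prop :=
  ∀ f, ι (θ f) = E (ι f)

theorem exists_lifts {ι : R →ₐ[ℂ] K} (hι : Function.Injective ι) {E : Derivation ℂ K K}
    (h : ∀ f, E (ι f) ∈ ι.range) : ∃ θ : Derivation ℂ R R, Lifts ι θ E := by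
  choose g hg using h
  have hg : ∀ f, ι (g f) = E (ι f) := hg
  refine ⟨Derivation.mk' ⟨⟨g, fun a b => hι ?_⟩, fun c a => hι ?_⟩ fun a b => hι ?_, hg⟩
  · simp only [map_add, hg]
  · simp only [map_smul, hg, RingHom.id_apply, E.map_smul]
  · simp only [LinearMap.coe_mk, AddHom.coe_mk, smul_eq_mul, map_add, map_mul, hg,
      Derivation.leibniz]

/-- The derivations of `K` that extend elements of `L`. -/
def liftLie (ι : R →ₐ[ℂ] K) (L : LieSubalgebra ℂ (Derivation ℂ R R)) :
    LieSubalgebra ℂ (Derivation ℂ K K) where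
  carrier := {E | ∃ θ ∈ L, Lifts ι θ E}
  zero_mem' := ⟨0, L.zero_mem, fun f => by simp⟩
  add_mem' := by
    rintro E F ⟨θ, h, h1⟩ ⟨η, h', h2⟩
    exact ⟨θ + η, L.add_mem h h', fun f => by simp [h1 f, h2 f]⟩
  smul_mem' := by
    rintro c E ⟨θ, h, h1⟩
    exact ⟨c • θ, L.smul_mem c h, fun f => by simp [h1 f]⟩
  lie_mem' := by
    rintro E F ⟨θ, h, h1⟩ ⟨η, h', h2⟩
    refine ⟨⁅θ, η⁆, L.lie_mem h h', fun f => ?_⟩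
    rw [Derivation.commutator_apply, Derivation.commutator_apply, map_sub, h1, h2, h2, h1]

end Lifts

/-! ### Pole orders of the chain derivations on the coordinate ring -/

section Regularity

variable {K : Type*} [Field K] [Algebra ℂ K]
variable {d : ℕ} {lam : ℕ → ℂ} {Pt : ℕ → Polynomial ℂ} {Z : ℕ → K} {E : Derivation ℂ K K}

theorem Rel.exists_pow_mul_mem_zero (h0 : lam 0 = 0) (hZ : Rel d lam Pt Z) (h1 : E (Z 0) = 0)
    (h2 : E (Z 1) = 1) :
    ∃ M : ℕ, ∀ b ∈ coordAlg Z (d + 1), Z 0 ^ M * E b ∈ coordAlg Z (d + 1) := by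
  have hh : Z 0 ∈ coordAlg Z (d + 1) := mem_coordAlg (by omega)
  refine exists_pow_mul_derivation_mem ((Set.finite_Iic _).image Z) hh ?_
  rintro _ ⟨l, hl, rfl⟩
  refine hZ.mem_of_ge (regularized (coordAlg Z (d + 1)) hh E)
    (mem_regularized hh hh (by rw [h1]; exact Subalgebra.zero_mem _))
    (mem_regularized hh (mem_coordAlg (by omega)) (by rw [h2]; exact Subalgebra.one_mem _))
    (fun q hq => ?_) l (Nat.zero_le _) hl
  refine mem_regularized_of_mul_mem hh (mul_one _).symm (Subalgebra.one_mem _) h1 ?_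
  simpa [shift, h0] using hq

/-- Lower coordinates require division by `z_{n+1}`, upper ones by `z_{n+1} - λ_{n+1}`; this is why
both linear factors must divide `c`. -/
theorem Rel.exists_pow_mul_mem_chart (hZ : Rel d lam Pt Z) {n : ℕ} (hn : n + 1 ≤ d)
    (h1 : E (Z (n + 1)) = 0) (h2 : E (Z n) = -shift lam Z n) (h3 : E (Z (n + 2)) = Z (n + 2))
    {c : Polynomial ℂ} (hc : Polynomial.X ∣ c)
    (hc' : Polynomial.X - Polynomial.C (lam (n + 1)) ∣ c) :
    ∃ M : ℕ, ∀ b ∈ coordAlg Z (d + 1),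
      Polynomial.aeval (Z (n + 1)) c ^ M * E b ∈ coordAlg Z (d + 1) := by
  have m1 : Z (n + 1) ∈ coordAlg Z (d + 1) := mem_coordAlg (by omega)
  have hh : Polynomial.aeval (Z (n + 1)) c ∈ coordAlg Z (d + 1) := aeval_mem _ m1 _
  have r1 := mem_regularized hh m1 (by rw [h1]; exact Subalgebra.zero_mem _)
  refine exists_pow_mul_derivation_mem ((Set.finite_Iic _).image Z) hh ?_
  rintro _ ⟨l, hl, rfl⟩
  rcases Nat.lt_or_ge l (n + 1) with hl' | hl'
  · refine hZ.mem_of_le (regularized (coordAlg Z (d + 1)) hh E) (i := n) (by omega)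
      (mem_regularized hh (mem_coordAlg (by omega)) ?_) r1 (fun q hq => ?_) l (by omega)
    · rw [h2]; exact neg_mem (shift_mem _ (mem_coordAlg (by omega)))
    · obtain ⟨g, rfl⟩ := hc
      refine mem_regularized_of_mul_mem hh (h₂ := Polynomial.aeval (Z (n + 1)) g) ?_
        (aeval_mem _ m1 _) h1 hq
      rw [map_mul, Polynomial.aeval_X]
  · refine hZ.mem_of_ge (regularized (coordAlg Z (d + 1)) hh E) r1
      (mem_regularized hh (mem_coordAlg (by omega)) ?_) (fun q hq => ?_) l hl' hl
    · rw [h3]; exact mem_coordAlg (by omega)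
    · obtain ⟨g, rfl⟩ := hc'
      refine mem_regularized_of_mul_mem hh (h₂ := Polynomial.aeval (Z (n + 1)) g) ?_
        (aeval_mem _ m1 _) ?_ hq
      · simp [shift]
      · rw [derivation_shift, h1]

theorem Rel.exists_pow_mul_mem_last (hZ : Rel d lam Pt Z) {μ : ℂ}
    (h1 : E (Z (d + 1)) = 0) (h2 : E (Z d) = -(Z d - algebraMap ℂ K μ))
    {c : Polynomial ℂ} (hc : Polynomial.X ∣ c) :
    ∃ M : ℕ, ∀ b ∈ coordAlg Z (d + 1),
      Polynomial.aeval (Z (d + 1)) c ^ M * E b ∈ coordAlg Z (d + 1) := by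
  have m1 : Z (d + 1) ∈ coordAlg Z (d + 1) := mem_coordAlg le_rfl
  obtain ⟨M, hM⟩ := hZ.exists_pow_mul_mem le_rfl h1 (by
    rw [h2]
    exact neg_mem (sub_mem (mem_coordAlg (by omega)) (Subalgebra.algebraMap_mem _ _)))
  obtain ⟨g, rfl⟩ := hc
  refine ⟨M, fun b hb => ?_⟩
  convert Subalgebra.mul_mem _ (aeval_mem _ m1 (g ^ M)) (hM b hb) using 1
  simp only [map_mul, map_pow, Polynomial.aeval_X]
  ring

end Regularity

/-! ### Complete regular vector fields -/

section Fields

theorem isComplete_of_forall {σ : Type} {S : Set (σ → ℂ)} {θ : VF S}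
    (h : ∀ p : S, (∀ f, evalAt p (θ f) = 0) ∨ ∃ γ : ℂ → S, γ 0 = p ∧ IsIntegral θ γ) :
    IsComplete θ := by
  intro p
  rcases h p with h | h
  · refine ⟨fun _ => p, rfl, fun t f => ?_⟩
    rw [h]
    exact hasDerivAt_const t _
  · exact h

variable {K : Type*} [Field K] [Algebra ℂ K]
variable {d : ℕ} {lam : ℕ → ℂ} {Pt : ℕ → Polynomial ℂ} {Z : ℕ → K} {E : Derivation ℂ K K}
variable {ι : CoordRing (surface d lam Pt) →ₐ[ℂ] K}

theorem range_eq_coordAlg (hZ : ∀ k ≤ d + 1, ι (coordFun d lam Pt k) = Z k) :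
    ι.range = coordAlg Z (d + 1) := by
  rw [← Algebra.map_top, ← adjoin_coordFun, AlgHom.map_adjoin, ← Set.image_comp, coordAlg]
  congr 1
  exact Set.image_congr fun k hk => hZ k hk

/-- Multiplying by one power more than needed for regularity gives a field vanishing where the
factor vanishes. -/
theorem exists_lifts_pow (hι : Function.Injective ι)
    (hZ : ∀ k ≤ d + 1, ι (coordFun d lam Pt k) = Z k) {h u : CoordRing (surface d lam Pt)} {M : ℕ}
    (hM : ∀ b ∈ coordAlg Z (d + 1), ι h ^ M * E b ∈ coordAlg Z (d + 1)) :
    ∃ θ : VF (surface d lam Pt), Lifts ι θ (ι (h ^ (M + 1) * u) • E) ∧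
      ∀ p, evalAt p h = 0 → ∀ f, evalAt p (θ f) = 0 := by
  rw [← range_eq_coordAlg hZ] at hM
  choose! g hg using hM
  have key : ∀ f, (ι (h ^ (M + 1) * u) • E) (ι f) = ι (h * u * g (ι f)) := by
    intro f
    have : ι (g (ι f)) = ι h ^ M * E (ι f) := hg (ι f) ⟨f, rfl⟩
    rw [map_mul ι (h * u), this, Derivation.smul_apply, smul_eq_mul]
    simp only [map_mul, map_pow]
    ring
  obtain ⟨θ, hθ⟩ := exists_lifts hι fun f => ⟨_, (key f).symm⟩
  refine ⟨θ, hθ, fun p hp f => ?_⟩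
  rw [hι ((hθ f).trans (key f)), map_mul, map_mul, hp, zero_mul, zero_mul]

theorem Lifts.apply_coordFun (hι : Function.Injective ι)
    (hZ : ∀ k ≤ d + 1, ι (coordFun d lam Pt k) = Z k) {θ : VF (surface d lam Pt)}
    {u : CoordRing (surface d lam Pt)} (hθ : Lifts ι θ (ι u • E)) {k : ℕ} (hk : k ≤ d + 1)
    {g : CoordRing (surface d lam Pt)} (hE : E (Z k) = ι g) :
    θ (coordFun d lam Pt k) = u * g := by
  apply hι
  rw [hθ, hZ k hk, Derivation.smul_apply, hE, smul_eq_mul, map_mul]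

theorem map_aeval_coordFun (hZ : ∀ k ≤ d + 1, ι (coordFun d lam Pt k) = Z k) {k : ℕ}
    (hk : k ≤ d + 1) (q : Polynomial ℂ) :
    ι (Polynomial.aeval (coordFun d lam Pt k) q) = Polynomial.aeval (Z k) q := by
  rw [← Polynomial.aeval_algHom_apply, hZ k hk]

theorem map_shift_coordFun (hZ : ∀ k ≤ d + 1, ι (coordFun d lam Pt k) = Z k) {k : ℕ}
    (hk : k ≤ d + 1) : ι (shift lam (coordFun d lam Pt) k) = shift lam Z k := by
  simp [shift, hZ k hk]

/-- A dichotomy that gives completeness: the field is zero where `c(z_{n+1}) = 0`, and elsewhere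
both divisions are legitimate and the exponential curves exist. The explicit form of `z_n` is kept
for the transitivity argument. -/
theorem exists_field_chart (h0 : lam 0 = 0) (hι : Function.Injective ι) (hrel : Rel d lam Pt Z)
    (hZ : ∀ k ≤ d + 1, ι (coordFun d lam Pt k) = Z k) {n : ℕ} (hn : n + 1 ≤ d)
    (h1 : E (Z (n + 1)) = 0) (h2 : E (Z n) = -shift lam Z n) (h3 : E (Z (n + 2)) = Z (n + 2))
    {c : Polynomial ℂ} (hc : Polynomial.X ∣ c)
    (hc' : Polynomial.X - Polynomial.C (lam (n + 1)) ∣ c) :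
    ∃ M : ℕ, ∀ q : Polynomial ℂ, ∃ θ : VF (surface d lam Pt),
      Lifts ι θ (Polynomial.aeval (Z (n + 1)) (c ^ (M + 1) * q) • E) ∧
      (∀ p : surface d lam Pt, c.eval (coord p.1 (n + 1)) = 0 → ∀ f, evalAt p (θ f) = 0) ∧
      ∀ p : surface d lam Pt, c.eval (coord p.1 (n + 1)) ≠ 0 →
        ∃ γ : ℂ → surface d lam Pt, γ 0 = p ∧ IsIntegral θ γ ∧
          (∀ t, coord (γ t).1 (n + 1) = coord p.1 (n + 1)) ∧
          ∀ t, coord (γ t).1 n = lam n + shift lam (coord p.1) n *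
            Complex.exp (-(c ^ (M + 1) * q).eval (coord p.1 (n + 1)) * t) := by
  obtain ⟨M, hM⟩ := hrel.exists_pow_mul_mem_chart hn h1 h2 h3 hc hc'
  refine ⟨M, fun q => ?_⟩
  have hn1 : n + 1 ≤ d + 1 := by omega
  rw [← map_aeval_coordFun hZ hn1] at hM
  obtain ⟨θ, hθ, hv⟩ := exists_lifts_pow hι hZ
    (u := Polynomial.aeval (coordFun d lam Pt (n + 1)) q) hM
  rw [← map_pow, ← map_mul] at hθ
  have a1 := hθ.apply_coordFun hι hZ hn1 (g := 0) (by rw [h1, map_zero])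
  have a2 := hθ.apply_coordFun hι hZ (k := n) (by omega) (g := -shift lam (coordFun d lam Pt) n)
    (by rw [h2, map_neg, map_shift_coordFun hZ (by omega)])
  have a3 := hθ.apply_coordFun hι hZ (k := n + 2) (by omega) (g := coordFun d lam Pt (n + 2))
    (by rw [h3, hZ _ (by omega)])
  rw [map_aeval_coordFun hZ hn1] at hθ
  refine ⟨θ, hθ, fun p hp => hv p (by rw [evalAt_aeval_coordFun, hp]), fun p hp => ?_⟩
  refine exists_integral_curve h0 hn (by rw [a1, mul_zero]) (a2.trans (by ring)) a3 p ?_ ?_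
  · obtain ⟨g, rfl⟩ := hc
    intro h
    rw [Polynomial.eval_mul, Polynomial.eval_X, h, zero_mul] at hp
    exact hp rfl
  · obtain ⟨g, rfl⟩ := hc'
    intro h
    rw [Polynomial.eval_mul, Polynomial.eval_sub, Polynomial.eval_X, Polynomial.eval_C] at hp
    exact hp (mul_eq_zero_of_left h _)

theorem exists_field_last (h0 : lam 0 = 0) (hd : 1 ≤ d) (hι : Function.Injective ι)
    (hrel : Rel d lam Pt Z) (hZ : ∀ k ≤ d + 1, ι (coordFun d lam Pt k) = Z k) {μ : ℂ}
    (h1 : E (Z (d + 1)) = 0) (h2 : E (Z d) = -(Z d - algebraMap ℂ K μ))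
    {c : Polynomial ℂ} (hc : Polynomial.X ∣ c) :
    ∃ M : ℕ, ∀ q : Polynomial ℂ, ∃ θ : VF (surface d lam Pt),
      Lifts ι θ (Polynomial.aeval (Z (d + 1)) (c ^ (M + 1) * q) • E) ∧
      (∀ p : surface d lam Pt, c.eval (coord p.1 (d + 1)) = 0 → ∀ f, evalAt p (θ f) = 0) ∧
      ∀ p : surface d lam Pt, c.eval (coord p.1 (d + 1)) ≠ 0 →
        ∃ γ : ℂ → surface d lam Pt, γ 0 = p ∧ IsIntegral θ γ ∧
          (∀ t, coord (γ t).1 (d + 1) = coord p.1 (d + 1)) ∧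
          ∀ t, coord (γ t).1 d = μ + (coord p.1 d - μ) *
            Complex.exp (-(c ^ (M + 1) * q).eval (coord p.1 (d + 1)) * t) := by
  obtain ⟨M, hM⟩ := hrel.exists_pow_mul_mem_last h1 h2 hc
  refine ⟨M, fun q => ?_⟩
  rw [← map_aeval_coordFun hZ le_rfl] at hM
  obtain ⟨θ, hθ, hv⟩ := exists_lifts_pow hι hZ
    (u := Polynomial.aeval (coordFun d lam Pt (d + 1)) q) hM
  rw [← map_pow, ← map_mul] at hθ
  have a1 := hθ.apply_coordFun hι hZ le_rfl (g := 0) (by rw [h1, map_zero])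
  have a2 := hθ.apply_coordFun hι hZ (k := d) (by omega)
    (g := -(coordFun d lam Pt d - algebraMap ℂ _ μ))
    (by rw [h2, map_neg, map_sub, hZ _ (by omega), AlgHom.commutes])
  rw [map_aeval_coordFun hZ le_rfl] at hθ
  refine ⟨θ, hθ, fun p hp => hv p (by rw [evalAt_aeval_coordFun, hp]), fun p hp => ?_⟩
  refine exists_integral_curve_last h0 hd (by rw [a1, mul_zero]) (a2.trans (by ring)) p ?_
  obtain ⟨g, rfl⟩ := hc
  intro h
  rw [Polynomial.eval_mul, Polynomial.eval_X, h, zero_mul] at hp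
  exact hp rfl

/-- With `z_0` constant along the flow, `z_1` satisfies a translation or a linear equation. The
second family, with the factor `Z 1`, is needed only for the first bracket computation. -/
theorem exists_field_zero (h0 : lam 0 = 0) (hι : Function.Injective ι) (hrel : Rel d lam Pt Z)
    (hZ : ∀ k ≤ d + 1, ι (coordFun d lam Pt k) = Z k)
    (h1 : E (Z 0) = 0) (h2 : E (Z 1) = 1) :
    ∃ M : ℕ, ∀ q : Polynomial ℂ,
      (∃ θ : VF (surface d lam Pt),
        Lifts ι θ (Polynomial.aeval (Z 0) (Polynomial.X ^ (M + 1) * q) • E) ∧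
        (∀ p : surface d lam Pt, coord p.1 0 = 0 → ∀ f, evalAt p (θ f) = 0) ∧
        ∀ p : surface d lam Pt, coord p.1 0 ≠ 0 →
          ∃ γ : ℂ → surface d lam Pt, γ 0 = p ∧ IsIntegral θ γ ∧
            (∀ t, coord (γ t).1 0 = coord p.1 0) ∧
            ∀ t, coord (γ t).1 1 = coord p.1 1 +
              (Polynomial.X ^ (M + 1) * q).eval (coord p.1 0) * t) ∧
      ∃ θ : VF (surface d lam Pt),
        Lifts ι θ ((Polynomial.aeval (Z 0) (Polynomial.X ^ (M + 1) * q) * Z 1) • E) ∧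
        (∀ p : surface d lam Pt, coord p.1 0 = 0 → ∀ f, evalAt p (θ f) = 0) ∧
        ∀ p : surface d lam Pt, coord p.1 0 ≠ 0 →
          ∃ γ : ℂ → surface d lam Pt, γ 0 = p ∧ IsIntegral θ γ := by
  obtain ⟨M, hM⟩ := hrel.exists_pow_mul_mem_zero h0 h1 h2
  rw [← hZ 0 (by omega)] at hM
  refine ⟨M, fun q => ?_⟩
  have e : Polynomial.aeval (Z 0) (Polynomial.X ^ (M + 1) * q) =
      ι (coordFun d lam Pt 0 ^ (M + 1) * Polynomial.aeval (coordFun d lam Pt 0) q) := by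
    rw [map_mul, map_mul, map_pow, map_pow, Polynomial.aeval_X, hZ _ (by omega),
      map_aeval_coordFun hZ (by omega)]
  refine ⟨?_, ?_⟩
  · obtain ⟨θ, hθ, hv⟩ := exists_lifts_pow hι hZ
      (u := Polynomial.aeval (coordFun d lam Pt 0) q) hM
    have a0 := hθ.apply_coordFun hι hZ (k := 0) (by omega) (g := 0) (by rw [h1, map_zero])
    have a1 := hθ.apply_coordFun hι hZ (k := 1) (by omega) (g := 1) (by rw [h2, map_one])
    refine ⟨θ, by rwa [e], fun p hp => hv p (by rw [evalAt_coordFun, hp]), fun p hp => ?_⟩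
    refine exists_integral_curve_zero h0 (by rw [a0, mul_zero]) p hp (φ := fun t => coord p.1 1 +
      (Polynomial.X ^ (M + 1) * q).eval (coord p.1 0) * t) (by simp) fun t s hs _ => ?_
    refine (((hasDerivAt_id t).const_mul _).const_add _).congr_deriv ?_
    rw [a1, map_mul, map_mul, map_pow, evalAt_aeval_coordFun, evalAt_coordFun, hs]
    simp
  · obtain ⟨θ, hθ, hv⟩ := exists_lifts_pow hι hZ
      (u := Polynomial.aeval (coordFun d lam Pt 0) q * coordFun d lam Pt 1) hM
    have a0 := hθ.apply_coordFun hι hZ (k := 0) (by omega) (g := 0) (by rw [h1, map_zero])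
    have a1 := hθ.apply_coordFun hι hZ (k := 1) (by omega) (g := 1) (by rw [h2, map_one])
    refine ⟨θ, ?_, fun p hp => hv p (by rw [evalAt_coordFun, hp]), fun p hp => ?_⟩
    · rwa [e, ← hZ 1 (by omega), ← map_mul, mul_assoc]
    · obtain ⟨γ, g1, g2, -⟩ := exists_integral_curve_zero h0 (by rw [a0, mul_zero]) p hp
        (φ := fun t => coord p.1 1 *
          Complex.exp ((Polynomial.X ^ (M + 1) * q).eval (coord p.1 0) * t)) (by simp)
        fun t s hs hs' => by
          refine (hasDerivAt_exp_mul _ _ t).congr_deriv ?_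
          rw [a1, mul_one, map_mul, map_mul, map_pow, evalAt_aeval_coordFun, evalAt_coordFun,
            evalAt_coordFun, hs, hs', Polynomial.eval_mul, Polynomial.eval_pow, Polynomial.eval_X]
          ring
      exact ⟨γ, g1, g2⟩

end Fields

end AffVar

namespace AffVar

/-! ### The exceptional finite set and transitivity outside it -/

section SpecialValues

variable {d : ℕ} {lam : ℕ → ℂ} {Pt : ℕ → Polynomial ℂ}

/-- The values of `z_{i+1}` forced by `z_0, …, z_i ∈ s` through an equation of the surface. -/
def forcedValues (lam : ℕ → ℂ) (Pt : ℕ → Polynomial ℂ) (i : ℕ) (s : Set ℂ) : Set ℂ :=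
  {v | ∃ m < i, ∃ z : ℕ → ℂ, (∀ l ≤ i, z l ∈ s) ∧
    v = next z m * shift lam z i * (∏ l ∈ Finset.Ioc m i, Polynomial.aeval (z l) (Pt l)) /
      shift lam z m}

theorem finite_forcedValues (i : ℕ) {s : Set ℂ} (hs : s.Finite) :
    (forcedValues lam Pt i s).Finite := by
  let ext (w : Fin (i + 1) → ℂ) (l : ℕ) : ℂ := if h : l < i + 1 then w ⟨l, h⟩ else 0
  have hw : (Set.pi Set.univ fun _ : Fin (i + 1) => s).Finite := Set.Finite.pi fun _ => hs
  refine ((Set.finite_Iio i).biUnion fun m _ => hw.image fun w =>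
    next (ext w) m * shift lam (ext w) i *
      (∏ l ∈ Finset.Ioc m i, Polynomial.aeval (ext w l) (Pt l)) / shift lam (ext w) m).subset ?_
  rintro v ⟨m, hm, z, hz, rfl⟩
  refine Set.mem_biUnion hm ⟨fun l => z l, fun l _ => hz l (by omega), ?_⟩
  have e : ∀ l ≤ i, ext (fun l => z l) l = z l := fun l hl => by
    simp only [ext, dif_pos (Nat.lt_succ_of_le hl)]
  simp only [shift, e i le_rfl, e m hm.le, next, e (m + 1) hm]
  congr 2
  exact Finset.prod_congr rfl fun l hl => by rw [e l (Finset.mem_Ioc.1 hl).2]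

/-- Finite sets of values `z_k` at which the flows used below are not available. -/
def specialValues (lam : ℕ → ℂ) (Pt : ℕ → Polynomial ℂ) : ℕ → Set ℂ
  | 0 => {0, lam 0} ∪ {u | (Pt 0).eval u = 0}
  | k + 1 => specialValues lam Pt k ∪ forcedValues lam Pt k (specialValues lam Pt k) ∪
      ({0, lam (k + 1)} ∪ {u | (Pt (k + 1)).eval u = 0})

theorem finite_specialValues (hPt : ∀ i, Pt i ≠ 0) (k : ℕ) : (specialValues lam Pt k).Finite := by
  have h : ∀ k, ({0, lam k} ∪ {u | (Pt k).eval u = 0} : Set ℂ).Finite := fun k =>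
    (Set.toFinite _).union (Polynomial.finite_setOfPred_isRoot (hPt k))
  induction k with
  | zero => exact h 0
  | succ k ih => exact (ih.union (finite_forcedValues k ih)).union (h (k + 1))

theorem specialValues_of_mem {k : ℕ} {u : ℂ}
    (h : u ∈ ({0, lam k} ∪ {u | (Pt k).eval u = 0} : Set ℂ)) : u ∈ specialValues lam Pt k := by
  cases k with
  | zero => exact h
  | succ k => exact Or.inr h

theorem zero_mem_specialValues (k : ℕ) : (0 : ℂ) ∈ specialValues lam Pt k :=
  specialValues_of_mem (Or.inl (Or.inl rfl))

theorem lam_mem_specialValues (k : ℕ) : lam k ∈ specialValues lam Pt k :=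
  specialValues_of_mem (Or.inl (Or.inr rfl))

theorem root_mem_specialValues {k : ℕ} {u : ℂ} (h : (Pt k).eval u = 0) :
    u ∈ specialValues lam Pt k := specialValues_of_mem (Or.inr h)

theorem monotone_specialValues : Monotone (specialValues lam Pt) :=
  monotone_nat_of_le_succ fun _ _ h => Or.inl (Or.inl h)

theorem exists_special_polynomial (hPt : ∀ i, Pt i ≠ 0) (k : ℕ) :
    ∃ c : Polynomial ℂ, c ≠ 0 ∧ Polynomial.X ∣ c ∧ Polynomial.X - Polynomial.C (lam k) ∣ c ∧
      ∀ u, c.eval u = 0 ↔ u ∈ specialValues lam Pt k := by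
  have hfin := finite_specialValues (lam := lam) hPt k
  have hdvd : ∀ u ∈ specialValues lam Pt k, Polynomial.X - Polynomial.C u ∣
      ∏ v ∈ hfin.toFinset, (Polynomial.X - Polynomial.C v) := fun u hu =>
    Finset.dvd_prod_of_mem (fun v => Polynomial.X - Polynomial.C v) (hfin.mem_toFinset.2 hu)
  refine ⟨∏ v ∈ hfin.toFinset, (Polynomial.X - Polynomial.C v),
    Finset.prod_ne_zero_iff.2 fun v _ => Polynomial.X_sub_C_ne_zero v, ?_,
    hdvd _ (lam_mem_specialValues k), fun u => ?_⟩
  · simpa using hdvd 0 (zero_mem_specialValues k)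
  · rw [Polynomial.eval_prod, Finset.prod_eq_zero_iff]
    simp only [Polynomial.eval_sub, Polynomial.eval_X, Polynomial.eval_C, sub_eq_zero,
      Set.Finite.mem_toFinset]
    exact ⟨fun ⟨v, hv, e⟩ => e ▸ hv, fun h => ⟨u, h, rfl⟩⟩

/-- The points with `z_0 = 0` all of whose coordinates are special. -/
def specialPoints (d : ℕ) (lam : ℕ → ℂ) (Pt : ℕ → Polynomial ℂ) : Set (surface d lam Pt) :=
  {p | coord p.1 0 = 0 ∧ ∀ k ≤ d + 1, coord p.1 k ∈ specialValues lam Pt k}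

theorem finite_specialPoints (hPt : ∀ i, Pt i ≠ 0) : (specialPoints d lam Pt).Finite := by
  have hw : (Set.pi Set.univ fun i : Fin (d + 2) => specialValues lam Pt i).Finite :=
    Set.Finite.pi fun i => finite_specialValues hPt i
  refine Set.Finite.of_finite_image (hw.subset ?_) Subtype.val_injective.injOn
  rintro _ ⟨p, hp, rfl⟩ i -
  have := hp.2 i (by omega)
  rwa [coord_val] at this

/-- The relation `(m-1, m)` gives `next z (m-1) * P̃_m(z_m) = 0`, so `z_m` is `0` or a root of
`P̃_m`. -/
theorem Rel.mem_specialValues {z : ℕ → ℂ} (hz : Rel d lam Pt z) {m : ℕ} (hm1 : 1 ≤ m) (hm : m ≤ d) (hlt : ∀ i < m, shift lam z i = 0) (hm0 : shift lam z m ≠ 0) :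
    z m ∈ specialValues lam Pt m := by
  obtain ⟨j, rfl⟩ : ∃ j, m = j + 1 := ⟨m - 1, by omega⟩
  have h := hz.next_mul_prod_eq_zero (lt_add_one j) hm (hlt j (by omega)) hm0
  rw [show Finset.Ioc j (j + 1) = {j + 1} by ext; simp, Finset.prod_singleton,
    Polynomial.coe_aeval_eq_eval] at h
  rcases mul_eq_zero.1 h with h | h
  · unfold next at h
    split_ifs at h
    · exact absurd h one_ne_zero
    · rw [h]; exact zero_mem_specialValues _
  · exact root_mem_specialValues h

theorem eq_lam_of_shift_eq_zero {z : ℕ → ℂ} {k : ℕ} (h : shift lam z k = 0) : z k = lam k :=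
  sub_eq_zero.1 h

/-- The coordinates beyond `z_{m+1}` are obtained from the relations `(m, i)` on dividing by `z_m -
λ_m`, so they are forced values of earlier special ones. -/
theorem Rel.forall_mem_specialValues {z : ℕ → ℂ} (hz : Rel d lam Pt z) {m : ℕ}
    (hm1 : 1 ≤ m) (hm : m ≤ d) (hlt : ∀ i < m, shift lam z i = 0) (hm0 : shift lam z m ≠ 0)
    (hz1 : z (m + 1) ∈ specialValues lam Pt (m + 1)) :
    ∀ k ≤ d + 1, z k ∈ specialValues lam Pt k := by
  intro k
  induction k using Nat.strong_induction_on with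
  | _ k ih =>
    intro hk
    rcases Nat.lt_or_ge k m with h1 | h1
    · rw [eq_lam_of_shift_eq_zero (hlt k h1)]; exact lam_mem_specialValues k
    obtain rfl | h2 := h1.eq_or_lt
    · exact hz.mem_specialValues hm1 hm hlt hm0
    obtain ⟨i, rfl⟩ : ∃ i, k = i + 1 := ⟨k - 1, by omega⟩
    obtain rfl | h3 := (Nat.le_of_lt_succ h2).eq_or_lt
    · exact hz1
    refine Or.inl (Or.inr ⟨m, h3, z, fun l hl => ?_, ?_⟩)
    · exact monotone_specialValues hl (ih l (by omega) (by omega))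
    · rw [← hz m i h3 (by omega), mul_div_cancel_left₀ _ hm0]

/-- A point with `z_0 = 0` outside `specialPoints` lies in a chart in which it can be moved. -/
theorem exists_chart_of_notMem_specialPoints (h0 : lam 0 = 0) (hd : 1 ≤ d) {p : surface d lam Pt}
    (h00 : coord p.1 0 = 0) (hp : p ∉ specialPoints d lam Pt) :
    (∃ m, 1 ≤ m ∧ m + 1 ≤ d ∧ shift lam (coord p.1) m ≠ 0 ∧
      coord p.1 (m + 1) ∉ specialValues lam Pt (m + 1)) ∨
    (coord p.1 d ∈ specialValues lam Pt d ∧ coord p.1 (d + 1) ∉ specialValues lam Pt (d + 1)) := by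
  classical
  have hz := rel_coord h0 p
  by_cases hex : ∃ m ≤ d, shift lam (coord p.1) m ≠ 0
  · obtain ⟨m, ⟨hm, hm0⟩, hmin⟩ : ∃ m, (m ≤ d ∧ shift lam (coord p.1) m ≠ 0) ∧
        ∀ i < m, ¬(i ≤ d ∧ shift lam (coord p.1) i ≠ 0) :=
      ⟨Nat.find hex, Nat.find_spec hex, fun i hi => Nat.find_min hex hi⟩
    have hlt : ∀ i < m, shift lam (coord p.1) i = 0 := fun i hi =>
      not_not.1 fun h => hmin i hi ⟨by omega, h⟩
    have hm1 : 1 ≤ m := by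
      by_contra h
      obtain rfl : m = 0 := by omega
      exact hm0 (by simp [shift, h0, h00])
    -- With `m` the first index where `z_m ≠ λ_m`, a special `z_{m+1}` would make every coordinate
    -- special.
    have hout : coord p.1 (m + 1) ∉ specialValues lam Pt (m + 1) := fun h =>
      hp ⟨h00, hz.forall_mem_specialValues hm1 hm hlt hm0 h⟩
    obtain rfl | h := hm.eq_or_lt
    · exact Or.inr ⟨hz.mem_specialValues hm1 hm hlt hm0, hout⟩
    · exact Or.inl ⟨m, hm1, h, hm0, hout⟩
  · have hs : ∀ k ≤ d, coord p.1 k ∈ specialValues lam Pt k := fun k hk => by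
      rw [eq_lam_of_shift_eq_zero (not_not.1 fun h => hex ⟨k, hk, h⟩)]
      exact lam_mem_specialValues k
    refine Or.inr ⟨hs d le_rfl, fun h => hp ⟨h00, fun k hk => ?_⟩⟩
    obtain rfl | h' := hk.eq_or_lt
    · exact h
    · exact hs k (by omega)

/-- A set of points that can be moved in every chart away from the special values is contained in
`specialPoints` or contains all points with `z_0 ≠ 0`. -/
theorem subset_specialPoints_or (h0 : lam 0 = 0) (hPt : ∀ i, Pt i ≠ 0) (hd : 1 ≤ d) {μ : ℂ}
    (hμ : μ ∉ specialValues lam Pt d) {V : Set (surface d lam Pt)}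
    (hV0 : ∀ p ∈ V, coord p.1 0 ≠ 0 → ∀ y, ∃ q ∈ V, coord q.1 0 = coord p.1 0 ∧ coord q.1 1 = y)
    (hV1 : ∀ n, n + 1 ≤ d → ∀ p ∈ V, coord p.1 (n + 1) ∉ specialValues lam Pt (n + 1) →
      ∀ u ≠ 0, ∃ q ∈ V, coord q.1 (n + 1) = coord p.1 (n + 1) ∧
        coord q.1 n = lam n + shift lam (coord p.1) n * u)
    (hV2 : ∀ p ∈ V, coord p.1 (d + 1) ∉ specialValues lam Pt (d + 1) →
      ∀ u ≠ 0, ∃ q ∈ V, coord q.1 (d + 1) = coord p.1 (d + 1) ∧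
        coord q.1 d = μ + (coord p.1 d - μ) * u) :
    V ⊆ specialPoints d lam Pt ∨ ∀ p : surface d lam Pt, coord p.1 0 ≠ 0 → p ∈ V := by
  have hs : ∀ q : surface d lam Pt, shift lam (coord q.1) 0 = coord q.1 0 := fun q => by
    simp [shift, h0]
  -- Three moves: bring `z_1` to a non-special value, rescale `z_0` to its target, then adjust
  -- `z_1`. On `z_0 ≠ 0` these two coordinates determine the point.
  have hopen : ∀ p ∈ V, coord p.1 0 ≠ 0 → ∀ q : surface d lam Pt, coord q.1 0 ≠ 0 → q ∈ V := by
    intro p hp hp0 q hq0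
    obtain ⟨y, hy⟩ := (finite_specialValues (lam := lam) hPt 1).infinite_compl.nonempty
    obtain ⟨p1, hp1, e1, e2⟩ := hV0 p hp hp0 y
    obtain ⟨p2, hp2, e3, e4⟩ := hV1 0 hd p1 hp1 (by rw [e2]; exact hy)
      (coord q.1 0 / coord p.1 0) (div_ne_zero hq0 hp0)
    rw [hs, e1, h0, zero_add, mul_div_cancel₀ _ hp0] at e4
    obtain ⟨p3, hp3, e5, e6⟩ := hV0 p2 hp2 (by rwa [e4]) (coord q.1 1)
    have e : p3 = q := surface_ext fun k hk =>
      (rel_coord h0 p3).eq_of_ge (rel_coord h0 q) (e5.trans e4) e6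
        (by rw [hs, e5, e4]; exact hq0) k (Nat.zero_le _) hk
    exact e ▸ hp3
  -- An orbit with `z_{n+1} = b ≠ 0` and `z_n` taking all values but `a` lies along a curve on which
  -- `z_0` is a nonzero polynomial in `z_n`; it therefore meets `z_0 ≠ 0`.
  have hline : ∀ n, 1 ≤ n → n ≤ d → ∀ a s b : ℂ, s ≠ 0 → b ≠ 0 →
      (∀ u ≠ 0, ∃ q ∈ V, coord q.1 (n + 1) = b ∧ coord q.1 n = a + s * u) →
      ∀ q : surface d lam Pt, coord q.1 0 ≠ 0 → q ∈ V := by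
    intro n hn hnd a s b hs0 hb h
    obtain ⟨W, hW, w1, w2, w0⟩ := exists_line (Pt := Pt) h0 hPt hn hb
    obtain ⟨v, hv⟩ : ∃ v, v ∉ ({v | (W 0).eval v = 0} ∪ {a} : Set ℂ) :=
      ((Polynomial.finite_setOfPred_isRoot w0).union (Set.finite_singleton a)).infinite_compl.nonempty
    rw [Set.mem_union, not_or] at hv
    obtain ⟨q, hq, e1, e2⟩ := h ((v - a) / s) (div_ne_zero (sub_ne_zero.2 hv.2) hs0)
    rw [mul_div_cancel₀ _ hs0, add_sub_cancel] at e2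
    refine hopen q hq ?_
    have e := ((rel_coord h0 q).mono hnd).eq_of_le (hW.eval v) le_rfl
      (by simp [w1, e2]) (by simp [w2, e1]) (by rwa [e1]) 0 (Nat.zero_le _)
    rw [e]
    exact hv.1
  by_cases hsub : V ⊆ specialPoints d lam Pt
  · exact Or.inl hsub
  · right
    obtain ⟨p, hp, hpA⟩ := Set.not_subset.1 hsub
    by_cases h00 : coord p.1 0 = 0
    · have hne : ∀ k, coord p.1 k ∉ specialValues lam Pt k → coord p.1 k ≠ 0 :=
        fun k h h' => h (by rw [h']; exact zero_mem_specialValues k)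
      rcases exists_chart_of_notMem_specialPoints h0 hd h00 hpA with
        ⟨m, hm1, hm, hm0, hout⟩ | ⟨hin, hout⟩
      · exact hline m hm1 (by omega) _ _ _ hm0 (hne _ hout) (hV1 m hm p hp hout)
      -- Here `z_d` is special and `μ` is not, so the recentered flow really moves the point.
      · refine hline d hd le_rfl _ _ _ (sub_ne_zero.2 ?_) (hne _ hout) (hV2 p hp hout)
        rintro h
        rw [h] at hin
        exact hμ hin
    · exact hopen p hp h00

end SpecialValues

end AffVar

namespace AffVar

/-! ### The ideal multiplying all vector fields into the Lie algebra -/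

section MultiplierIdeal

variable {R : Type*} [CommRing R] [Algebra ℂ R]

/-- The ideal of functions `t` with `t · Der R ⊆ L`. -/
def multiplierIdeal (L : LieSubalgebra ℂ (Derivation ℂ R R)) : Ideal R where
  carrier := {t | ∀ (r : R) (η : Derivation ℂ R R), (t * r) • η ∈ L}
  zero_mem' := fun r η => by rw [zero_mul, zero_smul]; exact L.zero_mem
  add_mem' := fun {a b} ha hb r η => by
    rw [add_mul, add_smul]; exact L.add_mem (ha r η) (hb r η)
  smul_mem' := fun c t ht r η => by
    rw [smul_eq_mul, mul_comm c, mul_assoc]; exact ht _ _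

theorem smul_mem_of_mem_multiplierIdeal {L : LieSubalgebra ℂ (Derivation ℂ R R)} {t : R}
    (ht : t ∈ multiplierIdeal L) (η : Derivation ℂ R R) : t • η ∈ L := by
  simpa using ht 1 η

/-- From `[θ, t r η] = θ(t) r η + t θ(r) η + t r [θ, η]`, where the last two terms lie in `L`
because `t` multiplies every derivation into `L`. -/
theorem apply_mem_multiplierIdeal {L : LieSubalgebra ℂ (Derivation ℂ R R)}
    {θ : Derivation ℂ R R} (hθ : θ ∈ L) {t : R} (ht : t ∈ multiplierIdeal L) :
    θ t ∈ multiplierIdeal L := by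
  intro r η
  have h := L.sub_mem (L.sub_mem (L.lie_mem hθ (ht r η)) (ht (θ r) η)) (ht r ⁅θ, η⁆)
  convert h using 1
  ext f
  simp only [Derivation.smul_apply, Derivation.sub_apply, Derivation.commutator_apply,
    Derivation.leibniz, smul_eq_mul]
  ring

end MultiplierIdeal

section NonzeroMultiplier

variable {K : Type*} [Field K] [Algebra ℂ K]
variable {d : ℕ} {lam : ℕ → ℂ} {Pt : ℕ → Polynomial ℂ} {Z : ℕ → K} {E F : Derivation ℂ K K}
variable {ι : CoordRing (surface d lam Pt) →ₐ[ℂ] K}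

/-- A derivation of `ℂ[S]` is a combination of two independent fields. -/
theorem apply_eq_of_frame (h0 : lam 0 = 0)
    (hZ : ∀ k ≤ d + 1, ι (coordFun d lam Pt k) = Z k) {μ : ℂ}
    (hE0 : E (Z d) = 0) (hE1 : E (Z (d + 1)) = Z (d + 1)) (hF1 : F (Z (d + 1)) = 0)
    (hF0 : F (Z d) = -(Z d - algebraMap ℂ K μ)) (hZ1 : Z (d + 1) ≠ 0)
    (hZ0 : Z d - algebraMap ℂ K μ ≠ 0) (η : VF (surface d lam Pt))
    (f : CoordRing (surface d lam Pt)) :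
    ι (η f) = ι (η (coordFun d lam Pt (d + 1))) / Z (d + 1) * E (ι f) -
      ι (η (coordFun d lam Pt d)) / (Z d - algebraMap ℂ K μ) * F (ι f) := by
  obtain ⟨a, ha⟩ : ∃ a, a = ι (η (coordFun d lam Pt (d + 1))) / Z (d + 1) := ⟨_, rfl⟩
  obtain ⟨b, hb⟩ : ∃ b, b = ι (η (coordFun d lam Pt d)) / (Z d - algebraMap ℂ K μ) := ⟨_, rfl⟩
  rw [← ha, ← hb]
  let S : Subalgebra ℂ (CoordRing (surface d lam Pt)) :=
    { carrier := {f | ι (η f) = a * E (ι f) - b * F (ι f)}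
      mul_mem' := fun {f g} hf hg => by
        change ι (η (f * g)) = a * E (ι (f * g)) - b * F (ι (f * g))
        have hf : ι (η f) = a * E (ι f) - b * F (ι f) := hf
        have hg : ι (η g) = a * E (ι g) - b * F (ι g) := hg
        simp only [Derivation.leibniz, smul_eq_mul, map_add, map_mul, hf, hg]
        ring
      add_mem' := fun {f g} hf hg => by
        change ι (η (f + g)) = a * E (ι (f + g)) - b * F (ι (f + g))
        have hf : ι (η f) = a * E (ι f) - b * F (ι f) := hf
        have hg : ι (η g) = a * E (ι g) - b * F (ι g) := hg
        simp only [map_add, hf, hg]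
        ring
      algebraMap_mem' := fun c => by
        change ι (η _) = a * E (ι _) - b * F (ι _)
        simp }
  have m0 : coordFun d lam Pt d ∈ S := by
    change ι (η _) = a * E (ι _) - b * F (ι _)
    rw [hZ d (by omega), hE0, hF0, hb]
    field_simp
    ring
  have m1 : coordFun d lam Pt (d + 1) ∈ S := by
    change ι (η _) = a * E (ι _) - b * F (ι _)
    rw [hZ (d + 1) le_rfl, hE1, hF1, ha]
    field_simp
    ring
  refine mem_of_coordFun_mem S (fun k hk => ?_) f
  refine (rel_coordFun h0).mem_of_le S le_rfl m0 m1 (fun q hq => ?_) k hk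
  have hq : ι (η (coordFun d lam Pt (d + 1) * q)) = a * E (ι (coordFun d lam Pt (d + 1) * q)) -
    b * F (ι (coordFun d lam Pt (d + 1) * q)) := hq
  have hm : ι (η (coordFun d lam Pt (d + 1))) = a * E (ι (coordFun d lam Pt (d + 1))) -
    b * F (ι (coordFun d lam Pt (d + 1))) := m1
  change ι (η q) = a * E (ι q) - b * F (ι q)
  refine mul_left_cancel₀ hZ1 ?_
  simp only [Derivation.leibniz, smul_eq_mul, map_add, map_mul, hm] at hq
  rw [hZ (d + 1) le_rfl] at hq
  linear_combination hq

/-- The element `c c' z_{d+1} (z_d - μ)` clears the denominators in `apply_eq_of_frame` and supplies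
the factors `c`, `c'` needed for membership in the Lie algebra. -/
theorem multiplierIdeal_ne_bot (h0 : lam 0 = 0) (hι : Function.Injective ι)
    (hZ : ∀ k ≤ d + 1, ι (coordFun d lam Pt k) = Z k) {μ : ℂ}
    (hE0 : E (Z d) = 0) (hE1 : E (Z (d + 1)) = Z (d + 1)) (hF1 : F (Z (d + 1)) = 0)
    (hF0 : F (Z d) = -(Z d - algebraMap ℂ K μ)) (hZ1 : Z (d + 1) ≠ 0)
    (hZ0 : Z d - algebraMap ℂ K μ ≠ 0) {L : LieSubalgebra ℂ (VF (surface d lam Pt))}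
    (hE : ∃ c ∈ coordAlg Z (d + 1), c ≠ 0 ∧ ∀ b ∈ coordAlg Z (d + 1), (c * b) • E ∈ liftLie ι L)
    (hF : ∃ c ∈ coordAlg Z (d + 1), c ≠ 0 ∧ ∀ b ∈ coordAlg Z (d + 1), (c * b) • F ∈ liftLie ι L) :
    multiplierIdeal L ≠ ⊥ := by
  rw [← range_eq_coordAlg hZ] at hE hF
  obtain ⟨_, ⟨c, rfl⟩, hc0, hc⟩ := hE
  obtain ⟨_, ⟨c', rfl⟩, hc0', hc'⟩ := hF
  obtain ⟨w, hw⟩ : ∃ w, w = coordFun d lam Pt d - algebraMap ℂ _ μ := ⟨_, rfl⟩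
  obtain ⟨v, hv⟩ : ∃ v, v = coordFun d lam Pt (d + 1) := ⟨_, rfl⟩
  have hιv : ι v = Z (d + 1) := by rw [hv, hZ _ le_rfl]
  have hιw : ι w = Z d - algebraMap ℂ K μ := by
    rw [hw, map_sub, hZ _ (by omega), AlgHom.commutes]
  have hmem : c * c' * v * w ∈ multiplierIdeal L := by
    intro r η
    obtain ⟨θ, hθ, e⟩ := hc _ ⟨c' * w * r * η v, rfl⟩
    obtain ⟨θ', hθ', e'⟩ := hc' _ ⟨c * v * r * η (coordFun d lam Pt d), rfl⟩
    convert L.sub_mem hθ hθ' using 1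
    ext f
    apply hι
    rw [Derivation.smul_apply, Derivation.sub_apply, map_sub, e f, e' f, smul_eq_mul, map_mul,
      apply_eq_of_frame h0 hZ hE0 hE1 hF1 hF0 hZ1 hZ0 η f, ← hιv, ← hιw, ← hv]
    rw [← hιv] at hZ1
    rw [← hιw] at hZ0
    change _ = (ι c * ι _) * E (ι f) - (ι c' * ι _) * F (ι f)
    simp only [map_mul]
    field_simp
  intro h
  rw [h, Ideal.mem_bot] at hmem
  have := congrArg ι hmem
  rw [map_zero, map_mul, map_mul, map_mul, hιv, hιw] at this
  exact mul_ne_zero (mul_ne_zero (mul_ne_zero hc0 hc0') hZ1) hZ0 this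

end NonzeroMultiplier

/-! ### From the multiplier ideal to the relative density property -/

section Density

variable {d : ℕ} {lam : ℕ → ℂ} {Pt : ℕ → Polynomial ℂ}

/-- A vector-field algebra whose multiplier ideal has zeros only on `A` gives the relative density
property. -/
theorem hasRelativeADP_of_zeroLocus {σ : Type} [Finite σ] {S : Set (σ → ℂ)} {A : Set S}
    (h : ∀ p : S, (∀ t ∈ multiplierIdeal (LieComplete A), evalAt p t = 0) → p ∈ A)
    (hS : ∀ p : σ → ℂ, (∀ F ∈ vanishingIdeal ℂ S, aeval p F = 0) → p ∈ S) :
    HasRelativeADP S A := by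
  set T := multiplierIdeal (LieComplete A)
  have hle : idealOf A ≤ T.radical := by
    intro f hf
    obtain ⟨F, rfl⟩ := Ideal.Quotient.mk_surjective f
    have hF : F ∈ (T.comap (Ideal.Quotient.mk _)).radical := by
      -- The Nullstellensatz is applied to the preimage of `T` in the polynomial ring.
      rw [← MvPolynomial.vanishingIdeal_zeroLocus_eq_radical (K := ℂ), mem_vanishingIdeal_iff]
      intro p hp
      rw [mem_zeroLocus_iff] at hp
      have hpS : p ∈ S := hS p fun G hG => hp G (by
        rw [Ideal.mem_comap, Ideal.Quotient.eq_zero_iff_mem.2 hG]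
        exact T.zero_mem)
      have hpA : (⟨p, hpS⟩ : S) ∈ A := h _ fun t ht => by
        obtain ⟨G, rfl⟩ := Ideal.Quotient.mk_surjective t
        exact hp G ht
      simp only [idealOf, Ideal.mem_iInf] at hf
      exact hf _ hpA
    obtain ⟨n, hn⟩ := hF
    exact ⟨n, by simpa using hn⟩
  obtain ⟨ℓ, hℓ⟩ := Ideal.exists_pow_le_of_le_radical_of_fg hle
    (IsNoetherian.noetherian (idealOf A))
  refine ⟨ℓ, fun θ hθ => ?_⟩
  refine Submodule.smul_induction_on hθ (fun t ht η _ => ?_) fun θ η h1 h2 => ?_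
  · exact smul_mem_of_mem_multiplierIdeal (hℓ ht) η
  · exact (LieComplete A).add_mem h1 h2

end Density

end AffVar

namespace AffVar

/-! ### Assembly of the proof -/

section MainProof

variable {d : ℕ} {lam : ℕ → ℂ} {Pt : ℕ → Polynomial ℂ}

theorem mem_surface_of_forall (h0 : lam 0 = 0) {p : Fin (d + 2) → ℂ}
    (h : ∀ F ∈ vanishingIdeal ℂ (surface d lam Pt), aeval p F = 0) : p ∈ surface d lam Pt := by
  have e := (rel_coordFun (d := d) (Pt := Pt) h0).map (Ideal.Quotient.liftₐ _ (aeval p) h)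
  refine (mem_surface_iff h0 p).2 (e.congr fun k _ => ?_)
  change _ = aeval p (X (Fin.ofNat (d + 2) k))
  rw [aeval_X]; rfl

theorem mem_lieComplete_of_curves {σ : Type} {S : Set (σ → ℂ)} {A : Set S} {θ : VF S}
    (hA : ∀ p ∈ A, ∀ f, evalAt p (θ f) = 0) {P : S → Prop}
    (hP : ∀ p, P p → ∀ f, evalAt p (θ f) = 0)
    (h : ∀ p, ¬P p → ∃ γ : ℂ → S, γ 0 = p ∧ IsIntegral θ γ) : θ ∈ LieComplete A :=
  LieSubalgebra.subset_lieSpan ⟨isComplete_of_forall fun p => by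
    by_cases hp : P p
    exacts [Or.inl (hP p hp), Or.inr (h p hp)], hA⟩

theorem exists_exp_mul_eq {F u : ℂ} (hF : F ≠ 0) (hu : u ≠ 0) : ∃ t, Complex.exp (F * t) = u :=
  ⟨Complex.log u / F, by rw [mul_div_cancel₀ _ hF, Complex.exp_log hu]⟩

theorem hasRelativeADP_specialPoints (hd : 1 ≤ d) (h0 : lam 0 = 0) (hPt : ∀ i, Pt i ≠ 0) :
    HasRelativeADP (surface d lam Pt) (specialPoints d lam Pt) := by
  obtain ⟨Z, D, hrel, hx, hy, hD⟩ := exists_generic_point d lam Pt h0 hPt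
  obtain ⟨ι, hι, hZ⟩ := exists_embedding h0 hPt hd hrel hx hy
  obtain ⟨μ, hμ⟩ := (finite_specialValues (lam := lam) hPt d).infinite_compl.nonempty
  choose c hc0 hcX hcl hc using fun k => exists_special_polynomial (lam := lam) hPt k
  set A := specialPoints d lam Pt
  have hcA : ∀ k ≤ d + 1, ∀ p ∈ A, (c k).eval (coord p.1 k) = 0 :=
    fun k hk p hp => (hc k _).2 (hp.2 k hk)
  have hD0 := hD 0 (by omega)
  have hDd := hD d le_rfl
  obtain ⟨M₀, H₀⟩ := exists_field_zero h0 hι hrel hZ hD0.apply_self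
    (by rw [hD0.apply_succ, next_zero])
  have hchart : ∀ n, n + 1 ≤ d → _ := fun n hn => exists_field_chart h0 hι hrel hZ hn
    (hD n (by omega)).apply_succ' (hD n (by omega)).apply_self'
    ((hD (n + 1) hn).apply_succ.trans (next_of_pos _ (by omega))) (hcX (n + 1)) (hcl (n + 1))
  choose! M H using hchart
  obtain ⟨M', H'⟩ := exists_field_last h0 hd hι hrel hZ (hDd.recenter_apply_succ μ)
    (hDd.recenter_apply_self μ) (hcX (d + 1))
  set L := LieComplete A
  have K₀ : ∀ q : Polynomial ℂ,
      Polynomial.aeval (Z 0) (Polynomial.X ^ (M₀ + 1) * q) • D 0 ∈ liftLie ι L := by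
    intro q
    obtain ⟨θ, h1, h2, h3⟩ := (H₀ q).1
    refine ⟨θ, mem_lieComplete_of_curves (fun p hp => h2 p hp.1) (hP := h2) fun p hp => ?_, h1⟩
    obtain ⟨γ, g1, g2, -⟩ := h3 p hp
    exact ⟨γ, g1, g2⟩
  have K₁ : ∀ q : Polynomial ℂ,
      (Polynomial.aeval (Z 0) (Polynomial.X ^ (M₀ + 1) * q) * Z 1) • D 0 ∈ liftLie ι L := by
    intro q
    obtain ⟨θ, h1, h2, h3⟩ := (H₀ q).2
    exact ⟨θ, mem_lieComplete_of_curves (fun p hp => h2 p hp.1) (hP := h2) h3, h1⟩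
  have hL : ∀ n (hn : n + 1 ≤ d) (q : Polynomial ℂ), (H n hn q).choose ∈ L := by
    intro n hn q
    obtain ⟨-, h2, h3⟩ := (H n hn q).choose_spec
    refine mem_lieComplete_of_curves (fun p hp => h2 p (hcA _ (by omega) p hp)) (hP := h2)
      fun p hp => ?_
    obtain ⟨γ, g1, g2, -⟩ := h3 p hp
    exact ⟨γ, g1, g2⟩
  have hL' : ∀ q : Polynomial ℂ, (H' q).choose ∈ L := by
    intro q
    obtain ⟨-, h2, h3⟩ := (H' q).choose_spec
    refine mem_lieComplete_of_curves (fun p hp => h2 p (hcA _ le_rfl p hp)) (hP := h2)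
      fun p hp => ?_
    obtain ⟨γ, g1, g2, -⟩ := h3 p hp
    exact ⟨γ, g1, g2⟩
  have hZd : Z (d + 1) ≠ 0 := by
    have := hDd.next_ne
    rwa [next_of_pos _ hd] at this
  have hZμ : Z d - algebraMap ℂ _ μ ≠ 0 := by
    obtain ⟨n, rfl⟩ : ∃ n, d = n + 1 := ⟨d - 1, by omega⟩
    simpa using (hD n (by omega)).aeval_ne_zero (Polynomial.X_sub_C_ne_zero μ)
  -- The polynomials `r k` record the vanishing order that makes each family of fields regular and
  -- complete; `M (k - 1)` belongs to the chart with coordinate `z_k`.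
  have hgood := exists_good hd hrel hD (L := liftLie ι L) (μ := μ)
    (r := fun k => if k = 0 then Polynomial.X ^ (M₀ + 1) else
      if k ≤ d then c k ^ (M (k - 1) + 1) else c k ^ (M' + 1)) (fun k => by
        split_ifs
        exacts [pow_ne_zero _ Polynomial.X_ne_zero, pow_ne_zero _ (hc0 k), pow_ne_zero _ (hc0 k)])
    K₀ K₁ (fun k hk hkd q => by
      obtain ⟨n, rfl⟩ : ∃ n, k = n + 1 := ⟨k - 1, by omega⟩
      rw [if_neg (by omega), if_pos hkd]
      exact ⟨_, hL n hkd q, (H n hkd q).choose_spec.1⟩) (fun q => by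
      rw [if_neg (by omega), if_neg (by omega)]
      exact ⟨_, hL' q, (H' q).choose_spec.1⟩)
  have hT := multiplierIdeal_ne_bot h0 hι hZ hDd.apply_self
    (hDd.apply_succ.trans (next_of_pos _ hd)) (hDd.recenter_apply_succ μ)
    (hDd.recenter_apply_self μ) hZd hZμ hgood.1 hgood.2
  set T := multiplierIdeal L with hTd
  set V : Set (surface d lam Pt) := {p | ∀ t ∈ T, evalAt p t = 0} with hV
  have hflow : ∀ θ ∈ L, ∀ γ : ℂ → surface d lam Pt, IsIntegral θ γ → γ 0 ∈ V → ∀ t, γ t ∈ V :=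
    fun θ hθ γ hγ h t f hf =>
      hγ.eq_zero (fun g hg => apply_mem_multiplierIdeal hθ hg) h hf t
  refine hasRelativeADP_of_zeroLocus (fun p hp => ?_) fun p hp => mem_surface_of_forall h0 hp
  refine (subset_specialPoints_or h0 hPt hd hμ (V := V) ?_ ?_ ?_).resolve_right (fun h => ?_) hp
  · intro p hp hp0 y
    obtain ⟨θ, h1, h2, h3⟩ := (H₀ 1).1
    obtain ⟨γ, g1, g2, g3, g4⟩ := h3 p hp0
    have hθ : θ ∈ L := by
      refine mem_lieComplete_of_curves (fun p hp => h2 p hp.1) (hP := h2) fun p hp => ?_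
      obtain ⟨γ, g1, g2, -⟩ := h3 p hp
      exact ⟨γ, g1, g2⟩
    have hw : (Polynomial.X ^ (M₀ + 1) * 1 : Polynomial ℂ).eval (coord p.1 0) ≠ 0 := by
      simpa using hp0
    refine ⟨_, hflow θ hθ γ g2 (by rwa [g1]) ((y - coord p.1 1) /
      (Polynomial.X ^ (M₀ + 1) * 1 : Polynomial ℂ).eval (coord p.1 0)), g3 _, ?_⟩
    rw [g4, mul_div_cancel₀ _ hw, add_sub_cancel]
  · intro n hn p hp hout u hu
    have hcp : (c (n + 1)).eval (coord p.1 (n + 1)) ≠ 0 := fun h => hout ((hc _ _).1 h)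
    obtain ⟨γ, g1, g2, g3, g4⟩ := (H n hn 1).choose_spec.2.2 p hcp
    obtain ⟨t, ht⟩ := exists_exp_mul_eq (F := -(c (n + 1) ^ (M n + 1) * 1).eval
      (coord p.1 (n + 1))) (by simpa using hcp) hu
    refine ⟨_, hflow _ (hL n hn 1) γ g2 (by rwa [g1]) t, g3 t, ?_⟩
    rw [g4, ht]
  · intro p hp hout u hu
    have hcp : (c (d + 1)).eval (coord p.1 (d + 1)) ≠ 0 := fun h => hout ((hc _ _).1 h)
    obtain ⟨γ, g1, g2, g3, g4⟩ := (H' 1).choose_spec.2.2 p hcp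
    obtain ⟨t, ht⟩ := exists_exp_mul_eq (F := -(c (d + 1) ^ (M' + 1) * 1).eval
      (coord p.1 (d + 1))) (by simpa using hcp) hu
    refine ⟨_, hflow _ (hL' 1) γ g2 (by rwa [g1]) t, g3 t, ?_⟩
    rw [g4, ht]
  -- If the zero set contained all points with `z_0 ≠ 0`, every element of `T` would vanish on a
  -- dense set, contradicting `T ≠ ⊥`.
  · refine hT ((Submodule.eq_bot_iff _).2 fun t ht => ?_)
    obtain ⟨F, rfl⟩ := Ideal.Quotient.mk_surjective t
    have hF : ∀ z : ℕ → ℂ, Rel d lam Pt z → z 0 ≠ 0 →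
        aeval (fun i : Fin (d + 2) => z i) F = 0 := fun z hz hz0 =>
      h ⟨_, restrict_mem_surface h0 hz⟩
        (by rw [coord_restrict z (Nat.zero_le _)]; exact hz0) _ ht
    refine coordRing_ext fun p => ?_
    have := Rel.aeval_eq_zero h0 hPt hd hF (rel_coord h0 p)
    rw [map_zero, evalAt_mk]
    simpa only [coord_val] using this

/-- The values of the parameters outside `1, …, d` play no role. -/
theorem surface_congr {lam' : ℕ → ℂ} {Pt' : ℕ → Polynomial ℂ}
    (h : ∀ k, 1 ≤ k → k ≤ d → lam k = lam' k ∧ Pt k = Pt' k) :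
    surface d lam Pt = surface d lam' Pt' := by
  have hprod : ∀ z : Fin (d + 2) → ℂ, ∀ j i, 1 ≤ j → i ≤ d →
      ∏ k ∈ Finset.Ico j i, (Pt k).eval (coord z k) =
        ∏ k ∈ Finset.Ico j i, (Pt' k).eval (coord z k) := fun z j i hj hi =>
    Finset.prod_congr rfl fun k hk => by
      have := Finset.mem_Ico.1 hk
      rw [(h k (by omega) (by omega)).2]
  have hfull : ∀ i, 1 ≤ i → i ≤ d → fullPoly lam Pt i = fullPoly lam' Pt' i := fun i h1 h2 => by
    rw [fullPoly, fullPoly, (h i h1 h2).1, (h i h1 h2).2]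
  ext z
  refine and_congr ?_ ?_
  · refine forall₃_congr fun i h1 h2 => ?_
    rw [hprod z 1 i le_rfl h2, hfull i h1 h2]
  · refine forall₅_congr fun j i h1 h2 h3 => ?_
    rw [hprod z j i (by omega) h3, hfull i (by omega) h3, (h (j - 1) (by omega) (by omega)).1]

end MainProof

end AffVar

theorem mainTheorem3 (d : ℕ) (hd : 1 ≤ d) (lam : ℕ → ℂ) (Pt : ℕ → Polynomial ℂ)
    (hPt : ∀ i, 1 ≤ i → i ≤ d → Pt i ≠ 0) :
    ∃ A : Set (AffVar.surface d lam Pt), A.Finite ∧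
      AffVar.HasRelativeADP (AffVar.surface d lam Pt) A := by
  -- The unused parameters are normalized to `λ_0 = 0` and `P̃_k = 1` outside `1, …, d`, as the
  -- uniform relations and the nonvanishing of all `P̃_k` demand.
  rw [AffVar.surface_congr (lam' := fun k => if k = 0 then 0 else lam k)
    (Pt' := fun k => if 1 ≤ k ∧ k ≤ d then Pt k else 1)
    fun k h1 h2 => ⟨(if_neg (by omega)).symm, (if_pos ⟨h1, h2⟩).symm⟩]
  have hPt' : ∀ k, (if 1 ≤ k ∧ k ≤ d then Pt k else 1) ≠ 0 := fun k => by
    split_ifs with h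
    exacts [hPt k h.1 h.2, one_ne_zero]
  exact ⟨_, AffVar.finite_specialPoints hPt',
    AffVar.hasRelativeADP_specialPoints hd (if_pos rfl) hPt'⟩
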